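/- Let $X,\Theta$ be measurable spaces, $(P_\theta)_{\theta\in\Theta}$ Markov kernels on $X$, and $\bar P(n;\cdot,\cdot)$, $n\ge 0$, Markov kernels on $X\times\Theta$ with $\bar P(n;(x,\theta);A\times\Theta)=P_\theta(x,A)$ for all $n,x,\theta$ and measurable $A$. For $l\ge 0$ let $\mathbb P^{(l)}_{x,\theta}$, $\mathbb E^{(l)}_{x,\theta}$ be the canonical law and expectation of the non-homogeneous Markov chain $Z_n=(X_n,\theta_n)$ started at $(x,\theta)$ with transition kernels $\bar P(l+n;\cdot,\cdot)$, $n\ge0$. For $W:X\to[1,\infty)$ put $|f|_W=\sup_x|f(x)|/W(x)$, $\|\mu\|_W=\sup_{|g|\le W}|\mu(g)|$, $\|\cdot\|_{\mathrm{TV}}=\|\cdot\|_1$, let $\mathcal L_W$ be the set of measurable $f$ with $|f|_W<\infty$, and put $D(\theta,\theta')=\sup_x\|P_\theta(x,\cdot)-P_{\theta'}(x,\cdot)\|_{\mathrm{TV}}$. Assume that there are a probability measure $\nu$ and a measurable set $C$ in $X$, a measurable $V:X\to[1,\infty)$, constants $\varepsilon,b,c>0$, $0<\alpha<1$, $0\le\beta_0<1-\alpha$,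 and a probability measure $\pi$ on $X$ such that: (1) $P_\theta(x,\cdot)\ge \varepsilon\,\mathbf 1_C(x)\,\nu(\cdot)$ for all $\theta,x$; (2) $P_\theta V\le V-cV^{1-\alpha}+b\mathbf 1_C$ for all $\theta$; (3) $\lim_n\sup_{\{V\le d\}\times\Theta}\|P_\theta^n(x,\cdot)-\pi\|_{V^{\beta_0}}=0$ for every $d$; (4) $\lim_n\sup_{l\ge0}\sup_{\{V\le d\}\times\Theta}\mathbb P^{(l)}_{x,\theta}(D(\theta_n,\theta_{n-1})\ge\delta)=0$ for every $d$ and every $\delta>0$. Let $0\le\beta<1-\alpha$. Then for all $f\in\mathcal L_{V^\beta}$, $(x,\theta)\in X\times\Theta$, $l\ge0$ and $0<a<1$, $f$ is $\pi$-integrable and, with $\bar f=f-\pi(f)$, the resolvent $$\hat g^{(l)}_a(x,\theta)=\sum_{j\ge0}(1-a)^{j+1}\,\mathbb E^{(l)}_{x,\theta}[\bar f(X_j)]$$ is well defined (the expectations exist and the series converges absolutely). Moreover there is a constant $\bar b\in[0,\infty)$, not depending on $\beta$, such that $P_\theta V^{s}\le V^{s}-s cV^{s-\alpha}+\bar b\mathbf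 1_C$ and $\mathbb E^{(l)}_{x,\theta}[V^{s}(X_j)]\le V^{s}(x)+\bar b j^{s}$ for all $0\le s\le1$, $j,l\ge0$, $x,\theta$ (with $0^0=1$), and such that, for every level set $\mathsf D=\{V\le d\}$ with $\nu(\mathsf D)>0$ and every $\epsilon>0$, there are integers $n\ge2$ and $n_\star\ge0$ such that for all $0<a<1$, $f\in\mathcal L_{V^\beta}$, $l\ge0$, $(x,\theta)\in X\times\Theta$ and $q\in[1,\infty]$ (with $1/q=0$ if $q=\infty$) $$\bigl|\hat g^{(l)}_a(x,\theta)\bigr|\le|\bar f|_{V^\beta}\Bigl(\frac{4\epsilon n}{1-(1-a)^n}+\frac{V^{\beta+\alpha/q}(x)}{a^{1-1/q}(1-a)^{1/q}}(\alpha c)^{-1/q}\Bigl(1+\frac{\bar b}{\varepsilon\nu(\mathsf D)}+2(1+\bar bn_\star)(1+\bar b)\sup_{\mathsf D}V^{\beta+\alpha/q}\Bigr)\Bigr).$$ In particular, for all $f\in\mathcal L_{V^\beta}$, $l\ge0$ and $(x,\theta)\in X\times\Theta$, $\lim_{a\downarrow0}a\,\hat g^{(l)}_a(x,\theta)=0$.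 -/

import Mathlib

open MeasureTheory ProbabilityTheory Set Filter Topology
open scoped ENNReal

noncomputable section

namespace AdaptiveMCMC

/-- The data of an adaptive Markov chain on `X × Θ`: a family `P θ` of Markov kernels on `X` and a
sequence of transition kernels `Pbar n` on `X × Θ` whose `X`-marginal from `(x, θ)` is `P θ x`.
(Measurability of `θ ↦ P θ x A` follows from `marginal`.) -/
structure AdaptiveChain (X Θ : Type*) [MeasurableSpace X] [MeasurableSpace Θ] where
  P : Θ → Kernel X X
  markov : ∀ θ, IsMarkovKernel (P θ)
  Pbar : ℕ → Kernel (X × Θ) (X × Θ)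
  markov_bar : ∀ n, IsMarkovKernel (Pbar n)
  marginal : ∀ (n : ℕ) (x : X) (θ : Θ) (A : Set X), MeasurableSet A →
    Pbar n (x, θ) (A ×ˢ (univ : Set Θ)) = P θ x A

variable {X Θ : Type*} [MeasurableSpace X] [MeasurableSpace Θ]

/-- The one-step kernel of the chain started at epoch `l`, as a kernel from histories up to time
`n` to the state at time `n + 1`: it is `Pbar (l + n)` applied to the current state. -/
def AdaptiveChain.stepKernel (M : AdaptiveChain X Θ) (l n : ℕ) :
    Kernel ((_ : Finset.Iic n) → X × Θ) (X × Θ) :=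
  (M.Pbar (l + n)).comap (fun h => h ⟨n, Finset.mem_Iic.2 le_rfl⟩) (measurable_pi_apply _)

instance (M : AdaptiveChain X Θ) (l n : ℕ) : IsMarkovKernel (M.stepKernel l n) := by
  have := M.markov_bar (l + n)
  unfold AdaptiveChain.stepKernel
  infer_instance

/-- The law on the canonical space `ℕ → X × Θ` of the non-homogeneous Markov chain with
transition kernels `Pbar (l + n)`, `n ≥ 0`, started at `z` (Ionescu-Tulcea). -/
def AdaptiveChain.law (M : AdaptiveChain X Θ) (l : ℕ) (z : X × Θ) : Measure (ℕ → X × Θ) :=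
  Kernel.traj (X := fun _ => X × Θ) (M.stepKernel l) 0 (fun _ => z)

/-- The `W`-norm `‖μ - ν‖_W` of the difference of two probability measures: the supremum of
`|μ g - ν g|` over measurable `g` with `|g| ≤ W` for which `μ g` and `ν g` make sense. -/
def wDist (W : X → ℝ) (μ ν : Measure X) : ℝ≥0∞ :=
  ⨆ (g : X → ℝ) (_ : Measurable g) (_ : ∀ x, |g x| ≤ W x) (_ : Integrable g μ)
    (_ : Integrable g ν), ENNReal.ofReal |∫ x, g x ∂μ - ∫ x, g x ∂ν|

/-- `D(θ, θ')`, the supremum over `x` of the total variation norm of `P θ x - P θ' x` (the total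
variation norm is the `W`-norm for `W = 1`, with values in `[0, 2]`). -/
def AdaptiveChain.D (M : AdaptiveChain X Θ) (θ θ' : Θ) : ℝ≥0∞ :=
  ⨆ x, wDist (fun _ => 1) (M.P θ x) (M.P θ' x)

/-- The `W`-norm `sup |f| / W` of a function (used for functions for which it is finite). -/
def wNorm (W f : X → ℝ) : ℝ := ⨆ x, |f x| / W x

/-- Membership in the space `L_W` of measurable functions with finite `W`-norm. -/
def MemL (W f : X → ℝ) : Prop :=
  Measurable f ∧ BddAbove (range fun x => |f x| / W x)

/-- Uniform minorization on `C`: `P θ x ≥ 1_C(x) ε ν` for all `θ`. -/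
def AdaptiveChain.Minorization (M : AdaptiveChain X Θ) (C : Set X) (ε : ℝ) (ν : Measure X) :
    Prop :=
  ∀ θ, ∀ x ∈ C, ENNReal.ofReal ε • ν ≤ M.P θ x

/-- `P θ W ≤ R` pointwise, for all `θ`; here `W` is nonnegative. -/
def AdaptiveChain.MeanLE (M : AdaptiveChain X Θ) (W R : X → ℝ) : Prop :=
  ∀ θ x, ∫⁻ y, ENNReal.ofReal (W y) ∂(M.P θ x) ≤ ENNReal.ofReal (R x)

/-- Uniform polynomial drift: `P θ V ≤ V - c V ^ (1 - α) + b 1_C` for all `θ`. -/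
def AdaptiveChain.Drift (M : AdaptiveChain X Θ) (C : Set X) (V : X → ℝ) (α b c : ℝ) : Prop :=
  M.MeanLE V (fun x => V x - c * V x ^ (1 - α) + b * C.indicator 1 x)

/-- On each level set of `V`, the iterates `P θ ^ n x` converge to `π` in `V ^ β`-norm, uniformly
in `x` and `θ`. -/
def AdaptiveChain.LevelSetErgodic (M : AdaptiveChain X Θ) (V : X → ℝ) (β : ℝ) (π : Measure X) :
    Prop :=
  ∀ d : ℝ, Tendsto
    (fun n : ℕ => ⨆ x ∈ {x | V x ≤ d}, ⨆ θ, wDist (fun y => V y ^ β) ((M.P θ ^ n) x) π)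
    atTop (𝓝 0)

/-- Diminishing adaptation, uniformly over starting epochs and over starting points in a level
set of `V`. -/
def AdaptiveChain.DiminishingAdaptation (M : AdaptiveChain X Θ) (V : X → ℝ) : Prop :=
  ∀ d ε : ℝ, 0 < ε → Tendsto
    (fun n : ℕ => ⨆ l : ℕ, ⨆ x ∈ {x | V x ≤ d}, ⨆ θ : Θ,
      M.law l (x, θ) {ω | ENNReal.ofReal ε ≤ M.D (ω (n + 1)).2 (ω n).2})
    atTop (𝓝 0)

/-- The centred function `f - π(f)`. -/
def centred (π : Measure X) (f : X → ℝ) (x : X) : ℝ := f x - ∫ y, f y ∂π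

/-- The resolvent `∑ j, (1 - a) ^ (j + 1) E_z^{(l)}[f(X_j) - π(f)]`. -/
def AdaptiveChain.resolvent (M : AdaptiveChain X Θ) (π : Measure X) (f : X → ℝ) (a : ℝ) (l : ℕ)
    (z : X × Θ) : ℝ :=
  ∑' j : ℕ, (1 - a) ^ (j + 1) * ∫ ω, centred π f (ω j).1 ∂(M.law l z)

/-- `1 / q` for an exponent `q ∈ [1, ∞]`, with `1 / ∞ = 0`. -/
def recip (q : ℝ≥0∞) : ℝ := (q⁻¹).toReal

end AdaptiveMCMC

end

open AdaptiveMCMC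

noncomputable section

namespace AdaptiveMCMC

/-! ### Marginals of the chain, and iterates of a kernel with frozen parameter. -/

section
variable {X Θ : Type*} [MeasurableSpace X] [MeasurableSpace Θ]

/-! Everything is proved for the larger sums of `(1 - a) ^ (j + 1) * |E h(X_j)|`, with `h` the
centred function, so absolute convergence comes with the bound.

From a level set (`exists_levelSet_bound`). Fix a lag `n` and compare `E h(X_{m+n})` with the mean
at time `m` of `P_θ^n h`, the parameter being frozen at its value at time `m`. Diminishing
adaptation makes the freezing error small for all `m` beyond a time that does not depend on `l` or
on the starting point in the level set (`abs_integral_iterFun_sub_le`). To have bounded functions,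
`h` is cut off outside a second level set `V ≤ d'`, on which ergodicity brings `P_θ^n` of the
truncation close to its `π`-mean. The removed tail, and the event that `X_m` lies outside `V ≤ d'`,
are charged to `V ^ (1 - α)` at the small rate `d' ^ (β - (1 - α))`. The drift pays for this:
discounted sums of `E V ^ (1 - α)` are at most `(V + b / a) / c`, and likewise `π(V ^ (1 - α)) ≤ b /
c` (`lintegral_stationary_le`). The result is `2 ε / a` plus a constant.

From an arbitrary point (`discounted_sum_le_of_levelSet`). Off the level set, a constant plus a
multiple of `V ^ s + κ 1_{Dᶜ}`, `s = β + α t`, is a supersolution of the resolvent equation. The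
killing `a` and the drift of `V ^ s` together dominate `V ^ β` by the weighted arithmetic-geometric
inequality (`rpow_interpolation`); the drift's excess on `C` is absorbed because the minorization
sends the chain from `C` into the level set with probability at least `ε₀ ν(D)`. Induction on the
number of terms, for all epochs at once, concludes.

The stated bound follows with `t = 1 / q`, the additive constant being absorbed into `nstar`; the
limit follows with `t = 1`. -/

instance (M : AdaptiveChain X Θ) (θ : Θ) : IsMarkovKernel (M.P θ) := M.markov θ

instance (M : AdaptiveChain X Θ) (n : ℕ) : IsMarkovKernel (M.Pbar n) := M.markov_bar n

instance (M : AdaptiveChain X Θ) (l : ℕ) (z : X × Θ) : IsProbabilityMeasure (M.law l z) := by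
  unfold AdaptiveChain.law
  infer_instance

/-- The transition kernel of the chain started at epoch `l` over `k` steps. -/
def AdaptiveChain.nStep (M : AdaptiveChain X Θ) (l : ℕ) : ℕ → Kernel (X × Θ) (X × Θ)
  | 0 => Kernel.id
  | k + 1 => M.Pbar (l + k) ∘ₖ M.nStep l k

instance (M : AdaptiveChain X Θ) (l k : ℕ) : IsMarkovKernel (M.nStep l k) := by
  induction k with
  | zero => unfold AdaptiveChain.nStep; infer_instance
  | succ k ih => unfold AdaptiveChain.nStep; infer_instance

theorem AdaptiveChain.nStep_succ (M : AdaptiveChain X Θ) (l k : ℕ) :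
    M.nStep l (k + 1) = M.Pbar (l + k) ∘ₖ M.nStep l k := rfl

theorem AdaptiveChain.nStep_succ' (M : AdaptiveChain X Θ) (l k : ℕ) :
    M.nStep l (k + 1) = M.nStep (l + 1) k ∘ₖ M.Pbar l := by
  induction k with
  | zero => simp [AdaptiveChain.nStep]
  | succ k ih =>
    rw [M.nStep_succ, ih, M.nStep_succ (l + 1) k, Kernel.comp_assoc,
      show l + 1 + k = l + (k + 1) by ring]

/-- The step kernel sees only the last coordinate of the history, so the Ionescu-Tulcea
disintegration survives projection to that coordinate. The pair law is needed because the adaptation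
error involves two consecutive parameters. -/
theorem AdaptiveChain.law_map_pair (M : AdaptiveChain X Θ) (l k : ℕ) (z : X × Θ) :
    (M.law l z).map (fun ω => (ω k, ω (k + 1))) =
      ((M.law l z).map (fun ω => ω k)) ⊗ₘ M.Pbar (l + k) := by
  have h := Kernel.partialTraj_compProd_eq_map_traj (X := fun _ => X × Θ) (κ := M.stepKernel l)
    (Nat.zero_le k) (x₀ := fun _ => z)
  have hm : Measurable (fun ω : ℕ → X × Θ => (ω k, ω (k + 1))) := by fun_prop
  rw [← Kernel.traj_map_frestrictLe_apply] at h
  ext s hs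
  have hg : Measurable (fun p : ((_ : Finset.Iic k) → X × Θ) × (X × Θ) =>
      (p.1 ⟨k, Finset.mem_Iic.2 le_rfl⟩, p.2)) := by fun_prop
  have h2 := congrArg (fun μ => μ.map (fun p : ((_ : Finset.Iic k) → X × Θ) × (X × Θ) =>
      (p.1 ⟨k, Finset.mem_Iic.2 le_rfl⟩, p.2)) s) h
  rw [Measure.map_map hg (by fun_prop), Measure.map_apply hg hs,
    Measure.compProd_apply (hg hs), lintegral_map (Kernel.measurable_kernel_prodMk_left (hg hs))
      (by fun_prop)] at h2
  rw [Measure.compProd_apply hs, lintegral_map (Kernel.measurable_kernel_prodMk_left hs)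
    (by fun_prop)]
  refine Eq.trans ?_ (h2.symm.trans ?_)
  · rfl
  · rfl

theorem AdaptiveChain.law_map_eval (M : AdaptiveChain X Θ) (l k : ℕ) (z : X × Θ) :
    (M.law l z).map (fun ω => ω k) = M.nStep l k z := by
  induction k with
  | zero =>
    have h := Kernel.traj_map_frestrictLe_apply (X := fun _ => X × Θ) (κ := M.stepKernel l) 0 0
      (fun _ => z)
    rw [Kernel.partialTraj_self, Kernel.id_apply] at h
    have hg : Measurable (fun p : ((_ : Finset.Iic 0) → X × Θ) => p ⟨0, Finset.mem_Iic.2 le_rfl⟩) :=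
      by fun_prop
    have h2 := congrArg (fun μ => μ.map
      (fun p : ((_ : Finset.Iic 0) → X × Θ) => p ⟨0, Finset.mem_Iic.2 le_rfl⟩)) h
    rw [Measure.map_map hg (by fun_prop), Measure.map_dirac' hg] at h2
    rw [AdaptiveChain.nStep, Kernel.id_apply]
    exact h2
  | succ k ih =>
    have h := congrArg Measure.snd (M.law_map_pair l k z)
    rw [Measure.snd_compProd, ih, Measure.snd, Measure.map_map measurable_snd (by fun_prop)] at h
    rw [M.nStep_succ, Kernel.comp_apply]
    exact h

theorem AdaptiveChain.Pbar_map_fst (M : AdaptiveChain X Θ) (n : ℕ) (x : X) (θ : Θ) :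
    (M.Pbar n (x, θ)).map Prod.fst = M.P θ x := by
  ext A hA
  rw [Measure.map_apply measurable_fst hA, ← M.marginal n x θ A hA, prod_univ]

theorem AdaptiveChain.integral_Pbar_fst (M : AdaptiveChain X Θ) (n : ℕ) (x : X) (θ : Θ)
    {g : X → ℝ} (hg : Measurable g) :
    ∫ z, g z.1 ∂(M.Pbar n (x, θ)) = ∫ y, g y ∂(M.P θ x) := by
  rw [← M.Pbar_map_fst n, integral_map measurable_fst.aemeasurable hg.aestronglyMeasurable]

theorem AdaptiveChain.lintegral_Pbar_fst (M : AdaptiveChain X Θ) (n : ℕ) (x : X) (θ : Θ)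
    {g : X → ℝ≥0∞} (hg : Measurable g) :
    ∫⁻ z, g z.1 ∂(M.Pbar n (x, θ)) = ∫⁻ y, g y ∂(M.P θ x) := by
  rw [← M.Pbar_map_fst n, lintegral_map hg measurable_fst]

/-- `z ↦ P z.2 z.1` as a kernel on `X × Θ`. -/
def AdaptiveChain.jointKernel (M : AdaptiveChain X Θ) : Kernel (X × Θ) X :=
  (M.Pbar 0).map Prod.fst

instance (M : AdaptiveChain X Θ) : IsMarkovKernel M.jointKernel := by
  unfold AdaptiveChain.jointKernel
  exact Kernel.IsMarkovKernel.map _ measurable_fst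

theorem AdaptiveChain.jointKernel_apply (M : AdaptiveChain X Θ) (z : X × Θ) :
    M.jointKernel z = M.P z.2 z.1 := by
  rw [AdaptiveChain.jointKernel, Kernel.map_apply _ measurable_fst]
  exact M.Pbar_map_fst 0 z.1 z.2

/-- The function `(x, θ) ↦ P_θ^r h (x)`. -/
def AdaptiveChain.iterFun (M : AdaptiveChain X Θ) (h : X → ℝ) : ℕ → X × Θ → ℝ
  | 0, z => h z.1
  | r + 1, z => ∫ y, M.iterFun h r (y, z.2) ∂(M.P z.2 z.1)

theorem AdaptiveChain.iterFun_succ (M : AdaptiveChain X Θ) (h : X → ℝ) (r : ℕ) (z : X × Θ) :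
    M.iterFun h (r + 1) z = ∫ y, M.iterFun h r (y, z.2) ∂(M.P z.2 z.1) := rfl

theorem AdaptiveChain.measurable_iterFun (M : AdaptiveChain X Θ) {h : X → ℝ} (hh : Measurable h)
    (r : ℕ) : Measurable (M.iterFun h r) := by
  induction r with
  | zero => exact hh.comp measurable_fst
  | succ r ih =>
    -- Measurability in `(x, θ)` jointly requires integrating against a single kernel on the
    -- product, which `jointKernel` supplies.
    have h1 : StronglyMeasurable (fun p : (X × Θ) × X => M.iterFun h r (p.2, p.1.2)) :=
      (ih.comp (by fun_prop)).stronglyMeasurable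
    have h2 := (h1.integral_kernel_prod_right' (κ := M.jointKernel)).measurable
    simp only [M.jointKernel_apply] at h2
    exact h2

theorem abs_integral_le_of_abs_le {Y : Type*} [MeasurableSpace Y] (μ : Measure Y)
    [IsProbabilityMeasure μ] {g : Y → ℝ} {B : ℝ} (hB : ∀ y, |g y| ≤ B) : |∫ y, g y ∂μ| ≤ B := by
  have h := norm_integral_le_of_norm_le_const (μ := μ) (f := g) (C := B)
    (Eventually.of_forall hB)
  simpa using h

theorem abs_integral_le_integral {Y : Type*} [MeasurableSpace Y] {μ : Measure Y} {f g : Y → ℝ}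
    (hg : Integrable g μ) (h : ∀ y, |f y| ≤ g y) : |∫ y, f y ∂μ| ≤ ∫ y, g y ∂μ := by
  rw [← Real.norm_eq_abs]
  exact norm_integral_le_of_norm_le hg (Eventually.of_forall h)

theorem integrable_of_abs_le {Y : Type*} [MeasurableSpace Y] (μ : Measure Y)
    [IsFiniteMeasure μ] {g : Y → ℝ} (hg : Measurable g) {B : ℝ} (hB : ∀ y, |g y| ≤ B) :
    Integrable g μ :=
  Integrable.of_bound hg.aestronglyMeasurable B (Eventually.of_forall hB)

theorem AdaptiveChain.abs_iterFun_le (M : AdaptiveChain X Θ) {h : X → ℝ} {B : ℝ}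
    (hB : ∀ y, |h y| ≤ B) (r : ℕ) (z : X × Θ) : |M.iterFun h r z| ≤ B := by
  induction r generalizing z with
  | zero => exact hB z.1
  | succ r ih => exact abs_integral_le_of_abs_le _ fun y => ih (y, z.2)

instance markov_pow (κ : Kernel X X) [IsMarkovKernel κ] (r : ℕ) : IsMarkovKernel (κ ^ r) := by
  induction r with
  | zero => rw [pow_zero]; exact inferInstanceAs (IsMarkovKernel Kernel.id)
  | succ r ih => rw [pow_succ]; exact inferInstanceAs (IsMarkovKernel ((κ ^ r) ∘ₖ κ))

theorem AdaptiveChain.iterFun_eq (M : AdaptiveChain X Θ) {h : X → ℝ} (hh : Measurable h) {B : ℝ}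
    (hB : ∀ y, |h y| ≤ B) (r : ℕ) (x : X) (θ : Θ) :
    M.iterFun h r (x, θ) = ∫ y, h y ∂((M.P θ ^ r) x) := by
  induction r generalizing x with
  | zero =>
    rw [pow_zero, show (1 : Kernel X X) = Kernel.id from rfl, Kernel.id_apply,
      integral_dirac' _ _ hh.stronglyMeasurable]
    rfl
  | succ r ih =>
    rw [pow_succ, show M.P θ ^ r * M.P θ = (M.P θ ^ r) ∘ₖ M.P θ from rfl,
      Kernel.integral_comp (integrable_of_abs_le _ hh hB), M.iterFun_succ]
    exact integral_congr_ae (Eventually.of_forall fun y => ih y)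

end

/-! ### Consequences of the polynomial drift condition. -/

section
-- Concavity of the power, obtained from Bernoulli's inequality for `y / v`. The free base point `v`
-- serves both the drift of `V ^ s` and the moment growth.
theorem rpow_le_tangent {y v s : ℝ} (hy : 0 ≤ y) (hv : 0 < v) (hs : 0 ≤ s) (hs1 : s ≤ 1) :
    y ^ s ≤ v ^ s + s * v ^ (s - 1) * (y - v) := by
  have h := rpow_one_add_le_one_add_mul_self (s := y / v - 1)
    (by have := div_nonneg hy hv.le; linarith) hs hs1
  rw [add_sub_cancel, Real.div_rpow hy hv.le, div_le_iff₀ (by positivity)] at h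
  rw [Real.rpow_sub_one hv.ne']
  calc y ^ s ≤ _ := h
    _ = _ := by field_simp

section Measure

variable {Y : Type*} [MeasurableSpace Y] {μ : Measure Y} {g : Y → ℝ}

theorem integrable_of_lintegral_ofReal_le (hg : Measurable g) (h0 : ∀ y, 0 ≤ g y) {r : ℝ}
    (h : ∫⁻ y, ENNReal.ofReal (g y) ∂μ ≤ ENNReal.ofReal r) : Integrable g μ :=
  (lintegral_ofReal_ne_top_iff_integrable hg.aestronglyMeasurable (Eventually.of_forall h0)).1
    (ne_top_of_le_ne_top ENNReal.ofReal_ne_top h)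

theorem integral_le_of_lintegral_ofReal_le (hg : Measurable g) (h0 : ∀ y, 0 ≤ g y) {r : ℝ}
    (hr : 0 ≤ r) (h : ∫⁻ y, ENNReal.ofReal (g y) ∂μ ≤ ENNReal.ofReal r) : ∫ y, g y ∂μ ≤ r := by
  rw [integral_eq_lintegral_of_nonneg_ae (Eventually.of_forall h0) hg.aestronglyMeasurable]
  exact ENNReal.toReal_le_of_le_ofReal hr h

theorem lintegral_ofReal_le_of_integral_le (hi : Integrable g μ) (h0 : ∀ y, 0 ≤ g y) {r : ℝ}
    (h : ∫ y, g y ∂μ ≤ r) : ∫⁻ y, ENNReal.ofReal (g y) ∂μ ≤ ENNReal.ofReal r := by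
  rw [← ofReal_integral_eq_lintegral_ofReal hi (Eventually.of_forall h0)]
  exact ENNReal.ofReal_le_ofReal h

/-- `ENNReal.ofReal` clips negative values, so a drift bound stated with it becomes a real
inequality only once its right side is known to be nonnegative. -/
theorem one_le_of_lintegral_ofReal_le [IsProbabilityMeasure μ] (h1 : ∀ y, 1 ≤ g y) {r : ℝ}
    (h : ∫⁻ y, ENNReal.ofReal (g y) ∂μ ≤ ENNReal.ofReal r) : 1 ≤ r := by
  have h2 : (1 : ℝ≥0∞) ≤ ∫⁻ y, ENNReal.ofReal (g y) ∂μ := by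
    calc (1 : ℝ≥0∞) = ∫⁻ _, 1 ∂μ := by simp
      _ ≤ _ := lintegral_mono fun y => ENNReal.one_le_ofReal.2 (h1 y)
  exact ENNReal.one_le_ofReal.1 (h2.trans h)

theorem integrable_rpow (hg : Measurable g) (h1 : ∀ y, 1 ≤ g y) (hi : Integrable g μ) {s : ℝ}
    (hs1 : s ≤ 1) : Integrable (fun y => g y ^ s) μ := by
  refine hi.mono' (hg.pow_const s).aestronglyMeasurable (Eventually.of_forall fun y => ?_)
  have hy : 0 ≤ g y := zero_le_one.trans (h1 y)
  rw [Real.norm_of_nonneg (by positivity)]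
  exact Real.rpow_le_self_of_one_le (h1 y) hs1

theorem integral_rpow_le [IsProbabilityMeasure μ] (hg : Measurable g) (h1 : ∀ y, 1 ≤ g y)
    (hi : Integrable g μ) {s v r : ℝ} (hs : 0 ≤ s) (hs1 : s ≤ 1) (hv : 0 < v)
    (hr : ∫ y, g y ∂μ ≤ r) :
    ∫ y, g y ^ s ∂μ ≤ v ^ s + s * v ^ (s - 1) * (r - v) := by
  have hi1 : Integrable (fun y => s * v ^ (s - 1) * (g y - v)) μ :=
    (hi.sub (integrable_const _)).const_mul _
  have hi2 : Integrable (fun y => v ^ s + s * v ^ (s - 1) * (g y - v)) μ :=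
    (integrable_const _).add hi1
  calc ∫ y, g y ^ s ∂μ ≤ ∫ y, (v ^ s + s * v ^ (s - 1) * (g y - v)) ∂μ :=
        integral_mono (integrable_rpow hg h1 hi hs1) hi2
          fun y => rpow_le_tangent (zero_le_one.trans (h1 y)) hv hs hs1
    _ = v ^ s + s * v ^ (s - 1) * (∫ y, g y ∂μ - v) := by
        rw [integral_add (integrable_const _) hi1,
          integral_const_mul, integral_sub hi (integrable_const _)]
        simp
    _ ≤ _ := by gcongr

theorem drift_step [IsProbabilityMeasure μ] {κ : Kernel Y Y} [IsMarkovKernel κ]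
    (hg : Measurable g) (h1 : ∀ y, 1 ≤ g y) {α b c : ℝ} (hα : 0 ≤ α)
    (hκ : ∀ y, ∫⁻ y', ENNReal.ofReal (g y') ∂κ y ≤
      ENNReal.ofReal (g y - c * g y ^ (1 - α) + b)) (hi : Integrable g μ) :
    Integrable g (κ ∘ₘ μ) ∧
      ∫ y, g y ∂(κ ∘ₘ μ) ≤ ∫ y, g y ∂μ - c * ∫ y, g y ^ (1 - α) ∂μ + b := by
  have hR1 : ∀ y, 1 ≤ g y - c * g y ^ (1 - α) + b := fun y =>
    one_le_of_lintegral_ofReal_le h1 (hκ y)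
  have hip := integrable_rpow hg h1 hi (s := 1 - α) (by linarith)
  have hRi1 : Integrable (fun y => g y - c * g y ^ (1 - α)) μ := hi.sub (hip.const_mul c)
  have hRi : Integrable (fun y => g y - c * g y ^ (1 - α) + b) μ :=
    hRi1.add (integrable_const b)
  have hRint : ∫ y, (g y - c * g y ^ (1 - α) + b) ∂μ =
      ∫ y, g y ∂μ - c * ∫ y, g y ^ (1 - α) ∂μ + b := by
    rw [integral_add hRi1 (integrable_const b),
      integral_sub hi (hip.const_mul c), integral_const_mul]
    simp
  have h0 : ∀ y, 0 ≤ g y := fun y => zero_le_one.trans (h1 y)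
  have hl : ∫⁻ y, ENNReal.ofReal (g y) ∂(κ ∘ₘ μ) ≤
      ENNReal.ofReal (∫ y, g y ∂μ - c * ∫ y, g y ^ (1 - α) ∂μ + b) := by
    rw [Measure.lintegral_bind κ.aemeasurable hg.ennreal_ofReal.aemeasurable, ← hRint,
      ofReal_integral_eq_lintegral_ofReal hRi
        (Eventually.of_forall fun y => zero_le_one.trans (hR1 y))]
    exact lintegral_mono hκ
  refine ⟨integrable_of_lintegral_ofReal_le hg h0 hl,
    integral_le_of_lintegral_ofReal_le hg h0 ?_ hl⟩
  rw [← hRint]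
  exact integral_nonneg fun y => zero_le_one.trans (hR1 y)

end Measure

theorem discounted_sum_le {u v : ℕ → ℝ} {b c r : ℝ} (hu : ∀ k, 0 ≤ u k)
    (huv : ∀ k, u (k + 1) ≤ u k - c * v k + b) (hr : 0 ≤ r) (hr1 : r ≤ 1) (N : ℕ) :
    c * ∑ k ∈ Finset.range N, r ^ k * v k ≤ u 0 + b * ∑ k ∈ Finset.range N, r ^ k := by
  -- Keeping the last term `r ^ N * u N` makes the sum telescope; it is dropped at the end by
  -- nonnegativity.
  suffices h : c * ∑ k ∈ Finset.range N, r ^ k * v k + r ^ N * u N ≤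
      u 0 + b * ∑ k ∈ Finset.range N, r ^ k by
    have := mul_nonneg (pow_nonneg hr N) (hu N)
    linarith
  induction N with
  | zero => simp
  | succ N ih =>
    rw [Finset.sum_range_succ, Finset.sum_range_succ]
    have h1 := mul_le_mul_of_nonneg_left (huv N) (pow_nonneg hr N)
    have h2 : r ^ (N + 1) * u (N + 1) ≤ r ^ N * u (N + 1) :=
      mul_le_mul_of_nonneg_right (pow_le_pow_of_le_one hr hr1 (Nat.le_succ N)) (hu _)
    nlinarith

variable {X Θ : Type*} [MeasurableSpace X] [MeasurableSpace Θ] {M : AdaptiveChain X Θ}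
  {C : Set X} {V : X → ℝ} {α b c : ℝ}

theorem AdaptiveChain.Drift.integrable (hdrift : M.Drift C V α b c) (hVm : Measurable V)
    (hV : ∀ x, 1 ≤ V x) (θ : Θ) (x : X) : Integrable V (M.P θ x) :=
  integrable_of_lintegral_ofReal_le hVm (fun y => zero_le_one.trans (hV y)) (hdrift θ x)

theorem AdaptiveChain.Drift.integral_le (hdrift : M.Drift C V α b c) (hVm : Measurable V)
    (hV : ∀ x, 1 ≤ V x) (θ : Θ) (x : X) :
    ∫ y, V y ∂(M.P θ x) ≤ V x - c * V x ^ (1 - α) + b * C.indicator 1 x :=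
  integral_le_of_lintegral_ofReal_le hVm (fun y => zero_le_one.trans (hV y))
    (zero_le_one.trans (one_le_of_lintegral_ofReal_le hV (hdrift θ x))) (hdrift θ x)

/-- The tangent at `V x` turns the drift of `V` into one for `V ^ s`. The factor `s * V x ^ (s - 1)`
is at most one, so the same `b` serves every `s`. -/
theorem AdaptiveChain.Drift.integral_rpow_le (hdrift : M.Drift C V α b c) (hVm : Measurable V)
    (hV : ∀ x, 1 ≤ V x) (hb : 0 ≤ b) {s : ℝ} (hs : 0 ≤ s) (hs1 : s ≤ 1) (θ : Θ) (x : X) :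
    ∫ y, V y ^ s ∂(M.P θ x) ≤
      V x ^ s - s * c * V x ^ (s - α) + b * C.indicator 1 x := by
  have hx : 0 < V x := zero_lt_one.trans_le (hV x)
  refine (AdaptiveMCMC.integral_rpow_le hVm hV (hdrift.integrable hVm hV θ x) hs hs1 hx
    (hdrift.integral_le hVm hV θ x)).trans ?_
  have h1 : V x ^ (s - 1) * V x ^ (1 - α) = V x ^ (s - α) := by
    rw [← Real.rpow_add hx]; congr 1; ring
  have h2 : V x ^ (s - 1) ≤ 1 := Real.rpow_le_one_of_one_le_of_nonpos (hV x) (by linarith)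
  have h3 : 0 ≤ b * C.indicator (1 : X → ℝ) x :=
    mul_nonneg hb (indicator_nonneg (fun _ _ => zero_le_one) x)
  have h4 : s * V x ^ (s - 1) ≤ 1 := by nlinarith [Real.rpow_nonneg hx.le (s - 1)]
  have h5 := mul_le_mul_of_nonneg_right h4 h3
  calc _ = V x ^ s - s * c * (V x ^ (s - 1) * V x ^ (1 - α)) +
        s * V x ^ (s - 1) * (b * C.indicator 1 x) := by ring
    _ ≤ _ := by rw [h1]; linarith

theorem AdaptiveChain.Drift.lintegral_le (hdrift : M.Drift C V α b c) (hb : 0 ≤ b) (θ : Θ)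
    (x : X) : ∫⁻ y, ENNReal.ofReal (V y) ∂(M.P θ x) ≤
      ENNReal.ofReal (V x - c * V x ^ (1 - α) + b) := by
  refine (hdrift θ x).trans (ENNReal.ofReal_le_ofReal ?_)
  have : C.indicator (1 : X → ℝ) x ≤ 1 := indicator_le_self' (fun _ _ => zero_le_one) x
  nlinarith

theorem AdaptiveChain.Drift.lintegral_Pbar_le (hdrift : M.Drift C V α b c) (hVm : Measurable V)
    (hb : 0 ≤ b) (n : ℕ) (z : X × Θ) : ∫⁻ z', ENNReal.ofReal (V z'.1) ∂(M.Pbar n z) ≤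
      ENNReal.ofReal (V z.1 - c * V z.1 ^ (1 - α) + b) := by
  have := M.lintegral_Pbar_fst n z.1 z.2 hVm.ennreal_ofReal
  rw [this]
  exact hdrift.lintegral_le hb z.2 z.1

theorem AdaptiveChain.Drift.integrable_nStep (hdrift : M.Drift C V α b c) (hVm : Measurable V)
    (hV : ∀ x, 1 ≤ V x) (hα : 0 ≤ α) (hb : 0 ≤ b) (l k : ℕ) (z : X × Θ) :
    Integrable (fun z' : X × Θ => V z'.1) (M.nStep l k z) := by
  induction k with
  | zero =>
    exact integrable_dirac' (hVm.comp measurable_fst).stronglyMeasurable (by simp)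
  | succ k ih =>
    exact (drift_step (κ := M.Pbar (l + k)) (g := fun z' : X × Θ => V z'.1)
      (hVm.comp measurable_fst) (fun z' => hV z'.1) hα
      (hdrift.lintegral_Pbar_le hVm hb (l + k)) ih).1

theorem AdaptiveChain.Drift.integral_nStep_succ_le (hdrift : M.Drift C V α b c)
    (hVm : Measurable V) (hV : ∀ x, 1 ≤ V x) (hα : 0 ≤ α) (hb : 0 ≤ b) (l k : ℕ) (z : X × Θ) :
    ∫ z', V z'.1 ∂(M.nStep l (k + 1) z) ≤
      ∫ z', V z'.1 ∂(M.nStep l k z) - c * ∫ z', V z'.1 ^ (1 - α) ∂(M.nStep l k z) + b :=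
  (drift_step (κ := M.Pbar (l + k)) (g := fun z' : X × Θ => V z'.1)
    (hVm.comp measurable_fst) (fun z' => hV z'.1) hα
    (hdrift.lintegral_Pbar_le hVm hb (l + k)) (hdrift.integrable_nStep hVm hV hα hb l k z)).2

theorem AdaptiveChain.integral_nStep_zero (M : AdaptiveChain X Θ) (l : ℕ) (z : X × Θ)
    {g : X × Θ → ℝ} (hg : Measurable g) : ∫ z', g z' ∂(M.nStep l 0 z) = g z :=
  integral_dirac' _ _ hg.stronglyMeasurable

theorem AdaptiveChain.Drift.integral_nStep_le (hdrift : M.Drift C V α b c) (hVm : Measurable V)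
    (hV : ∀ x, 1 ≤ V x) (hα : 0 ≤ α) (hb : 0 ≤ b) (hc : 0 ≤ c) (l k : ℕ) (z : X × Θ) :
    ∫ z', V z'.1 ∂(M.nStep l k z) ≤ V z.1 + b * k := by
  induction k with
  | zero =>
    rw [M.integral_nStep_zero l z (g := fun z' => V z'.1) (hVm.comp measurable_fst)]
    simp
  | succ k ih =>
    have h := hdrift.integral_nStep_succ_le hVm hV hα hb l k z
    have h2 : 0 ≤ c * ∫ z', V z'.1 ^ (1 - α) ∂(M.nStep l k z) :=
      mul_nonneg hc (integral_nonneg fun z' => Real.rpow_nonneg (zero_le_one.trans (hV z'.1)) _)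
    push_cast
    linarith

theorem AdaptiveChain.Drift.integrable_rpow_nStep (hdrift : M.Drift C V α b c)
    (hVm : Measurable V) (hV : ∀ x, 1 ≤ V x) (hα : 0 ≤ α) (hb : 0 ≤ b) {s : ℝ} (hs1 : s ≤ 1)
    (l k : ℕ) (z : X × Θ) : Integrable (fun z' : X × Θ => V z'.1 ^ s) (M.nStep l k z) :=
  integrable_rpow (hVm.comp measurable_fst) (fun z' => hV z'.1)
    (hdrift.integrable_nStep hVm hV hα hb l k z) hs1

theorem AdaptiveChain.Drift.integral_rpow_nStep_le (hdrift : M.Drift C V α b c)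
    (hVm : Measurable V) (hV : ∀ x, 1 ≤ V x) (hα : 0 ≤ α) (hb : 0 ≤ b) (hc : 0 ≤ c) {s : ℝ}
    (hs : 0 ≤ s) (hs1 : s ≤ 1) (l k : ℕ) (z : X × Θ) :
    ∫ z', V z'.1 ^ s ∂(M.nStep l k z) ≤ V z.1 ^ s + max b 1 * (k : ℝ) ^ s := by
  have hz : 0 < V z.1 := zero_lt_one.trans_le (hV z.1)
  have hbk : 0 ≤ b * (k : ℝ) := by positivity
  -- With the base point equal to the bound on the mean, the linear term of the tangent vanishes;
  -- subadditivity of the power then separates the two summands.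
  have h := AdaptiveMCMC.integral_rpow_le (hVm.comp measurable_fst) (fun z' => hV z'.1)
    (hdrift.integrable_nStep hVm hV hα hb l k z) hs hs1 (v := V z.1 + b * k) (by linarith)
    (hdrift.integral_nStep_le hVm hV hα hb hc l k z)
  rw [sub_self, mul_zero, add_zero] at h
  refine h.trans ((Real.rpow_add_le_add_rpow hz.le hbk hs hs1).trans ?_)
  rw [Real.mul_rpow hb (by positivity)]
  gcongr
  calc b ^ s ≤ (max b 1) ^ s := by gcongr; exact le_max_left _ _
    _ ≤ max b 1 := Real.rpow_le_self_of_one_le (le_max_right _ _) hs1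

theorem AdaptiveChain.Drift.discounted_sum_le (hdrift : M.Drift C V α b c)
    (hVm : Measurable V) (hV : ∀ x, 1 ≤ V x) (hα : 0 ≤ α) (hb : 0 ≤ b) {r : ℝ}
    (hr : 0 ≤ r) (hr1 : r ≤ 1) (l N : ℕ) (z : X × Θ) :
    c * ∑ k ∈ Finset.range N, r ^ k * ∫ z', V z'.1 ^ (1 - α) ∂(M.nStep l k z) ≤
      V z.1 + b * ∑ k ∈ Finset.range N, r ^ k := by
  have h := AdaptiveMCMC.discounted_sum_le (u := fun k => ∫ z', V z'.1 ∂(M.nStep l k z))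
    (fun k => integral_nonneg fun z' => zero_le_one.trans (hV z'.1))
    (hdrift.integral_nStep_succ_le hVm hV hα hb l · z) hr hr1 N
  rwa [M.integral_nStep_zero l z (g := fun z' => V z'.1) (hVm.comp measurable_fst)] at h

/-- The stationary moment bound inherited from the drift condition by Cesàro averaging. -/
theorem AdaptiveChain.Drift.lintegral_stationary_le (hdrift : M.Drift C V α b c)
    (hVm : Measurable V) (hV : ∀ x, 1 ≤ V x) (hα : 0 ≤ α) (hb : 0 ≤ b) (hc : 0 < c)
    (θ : Θ) (x : X) {π : Measure X} [IsProbabilityMeasure π]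
    (hπ : ∀ g : X → ℝ, Measurable g → (∃ B, ∀ y, |g y| ≤ B) →
      Tendsto (fun n : ℕ => ∫ y, g y ∂((M.P θ ^ n) x)) atTop (𝓝 (∫ y, g y ∂π))) :
    ∫⁻ y, ENNReal.ofReal (V y ^ (1 - α)) ∂π ≤ ENNReal.ofReal (b / c) := by
  have hstep : ∀ n, ((M.P θ ^ (n + 1)) x) = M.P θ ∘ₘ ((M.P θ ^ n) x) := fun n => by
    rw [pow_succ']; rfl
  have hint : ∀ n, Integrable V ((M.P θ ^ n) x) := by
    intro n
    induction n with
    | zero => exact integrable_dirac' hVm.stronglyMeasurable (by simp)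
    | succ n ih =>
      rw [hstep]
      exact (drift_step hVm hV hα (fun y => hdrift.lintegral_le hb θ y) ih).1
  have hrec : ∀ n, ∫ y, V y ∂((M.P θ ^ (n + 1)) x) ≤ ∫ y, V y ∂((M.P θ ^ n) x) -
      c * ∫ y, V y ^ (1 - α) ∂((M.P θ ^ n) x) + b := by
    intro n
    rw [hstep]
    exact (drift_step hVm hV hα (fun y => hdrift.lintegral_le hb θ y) (hint n)).2
  have hsum : ∀ N : ℕ, c * ∑ k ∈ Finset.range N, ∫ y, V y ^ (1 - α) ∂((M.P θ ^ k) x) ≤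
      V x + b * N := by
    intro N
    -- Discount factor one: the sum is an ordinary one, ready for Cesàro averaging.
    have h := AdaptiveMCMC.discounted_sum_le (u := fun k => ∫ y, V y ∂((M.P θ ^ k) x))
      (fun k => integral_nonneg fun y => zero_le_one.trans (hV y)) hrec zero_le_one le_rfl N
    have h0 : ∫ y, V y ∂((M.P θ ^ 0) x) = V x := integral_dirac' _ _ hVm.stronglyMeasurable
    rw [h0] at h
    simpa only [one_pow, one_mul, Finset.sum_const, Finset.card_range, nsmul_eq_mul,
      mul_one] using h
  have hVp : ∀ y, 0 ≤ V y ^ (1 - α) := fun y => Real.rpow_nonneg (zero_le_one.trans (hV y)) _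
  -- Convergence to `π` is available for bounded functions only, hence the truncation at `R`;
  -- monotone convergence removes it below.
  have htr : ∀ R : ℕ, ∫ y, min (V y ^ (1 - α)) R ∂π ≤ b / c := by
    intro R
    have hm : Measurable fun y => min (V y ^ (1 - α)) (R : ℝ) :=
      (hVm.pow_const _).min measurable_const
    have ht := (hπ _ hm ⟨R, fun y => by
      rw [abs_of_nonneg (le_min (hVp y) (Nat.cast_nonneg R))]; exact min_le_right _ _⟩).cesaro
    have ht2 : Tendsto (fun N : ℕ => (V x / c) * (N : ℝ)⁻¹ + b / c) atTop (𝓝 (b / c)) := by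
      have := ((tendsto_inv_atTop_nhds_zero_nat (𝕜 := ℝ)).const_mul (V x / c)).add_const (b / c)
      simpa using this
    refine le_of_tendsto_of_tendsto ht ht2 ?_
    filter_upwards [eventually_gt_atTop 0] with N hN
    have hN' : (0 : ℝ) < N := by exact_mod_cast hN
    have hle : ∑ k ∈ Finset.range N, ∫ y, min (V y ^ (1 - α)) (R : ℝ) ∂((M.P θ ^ k) x) ≤
        ∑ k ∈ Finset.range N, ∫ y, V y ^ (1 - α) ∂((M.P θ ^ k) x) :=
      Finset.sum_le_sum fun k _ => integral_mono_of_nonneg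
        (Eventually.of_forall fun y => le_min (hVp y) (Nat.cast_nonneg R))
        (integrable_rpow hVm hV (hint k) (by linarith))
        (Eventually.of_forall fun y => min_le_left _ _)
    have h3 : ∑ k ∈ Finset.range N, ∫ y, min (V y ^ (1 - α)) (R : ℝ) ∂((M.P θ ^ k) x) ≤
        (V x + b * N) / c := by
      rw [le_div_iff₀ hc]
      nlinarith [hsum N]
    calc _ ≤ (N : ℝ)⁻¹ * ((V x + b * N) / c) := by gcongr
      _ = _ := by field_simp
  have hlim : Tendsto (fun R : ℕ => ∫⁻ y, ENNReal.ofReal (min (V y ^ (1 - α)) R) ∂π) atTop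
      (𝓝 (∫⁻ y, ENNReal.ofReal (V y ^ (1 - α)) ∂π)) := by
    refine lintegral_tendsto_of_tendsto_of_monotone
      (fun R => (((hVm.pow_const _).min measurable_const).ennreal_ofReal).aemeasurable)
      (Eventually.of_forall fun y R R' hR => ?_) (Eventually.of_forall fun y => ?_)
    · exact ENNReal.ofReal_le_ofReal (min_le_min_left _ (by exact_mod_cast hR))
    · refine tendsto_const_nhds.congr' ?_
      filter_upwards [eventually_ge_atTop ⌈V y ^ (1 - α)⌉₊] with R hR
      rw [min_eq_left (Nat.ceil_le.1 hR)]
  refine le_of_tendsto hlim (Eventually.of_forall fun R => ?_)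
  refine lintegral_ofReal_le_of_integral_le (integrable_of_abs_le π
    ((hVm.pow_const _).min measurable_const) (B := R) fun y => ?_)
    (fun y => le_min (hVp y) (Nat.cast_nonneg R)) (htr R)
  rw [abs_of_nonneg (le_min (hVp y) (Nat.cast_nonneg R))]
  exact min_le_right _ _

end

/-! ### Freezing the parameter: errors controlled by adaptation. -/

section
theorem abs_integral_sub_le_of_wDist_le {X : Type*} [MeasurableSpace X] {W g : X → ℝ}
    {μ ν : Measure X} [IsProbabilityMeasure μ] [IsProbabilityMeasure ν] (hW : ∀ x, 1 ≤ W x)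
    (hg : Measurable g) {B δ : ℝ} (hB : ∀ x, |g x| ≤ B) (hδ : 0 ≤ δ)
    (h : wDist W μ ν ≤ ENNReal.ofReal δ) : |∫ x, g x ∂μ - ∫ x, g x ∂ν| ≤ B * δ := by
  obtain ⟨x₀⟩ : Nonempty X := μ.nonempty_of_neZero
  -- The main case divides by `B`; when `B = 0` the function vanishes.
  rcases ((abs_nonneg _).trans (hB x₀)).eq_or_lt with hB0 | hB0
  · have h0 : g = fun _ => 0 := funext fun x => abs_nonpos_iff.1 ((hB x).trans hB0.ge)
    simp [h0, ← hB0]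
  · have hb : ∀ x, |B⁻¹ * g x| ≤ 1 := fun x => by
      rw [abs_mul, abs_inv, abs_of_pos hB0, inv_mul_le_iff₀ hB0, mul_one]
      exact hB x
    have hm : Measurable fun x => B⁻¹ * g x := hg.const_mul _
    have h1 : ENNReal.ofReal |∫ x, B⁻¹ * g x ∂μ - ∫ x, B⁻¹ * g x ∂ν| ≤ ENNReal.ofReal δ := by
      refine le_trans ?_ h
      unfold wDist
      exact le_iSup_of_le (fun x => B⁻¹ * g x) (le_iSup_of_le hm (le_iSup_of_le
        (fun x => (hb x).trans (hW x)) (le_iSup_of_le (integrable_of_abs_le μ hm hb)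
        (le_iSup_of_le (integrable_of_abs_le ν hm hb) le_rfl))))
    rw [ENNReal.ofReal_le_ofReal_iff hδ, integral_const_mul, integral_const_mul, ← mul_sub,
      abs_mul, abs_inv, abs_of_pos hB0, inv_mul_le_iff₀ hB0] at h1
    exact h1

variable {X Θ : Type*} [MeasurableSpace X] [MeasurableSpace Θ] {M : AdaptiveChain X Θ}
  {C : Set X} {V : X → ℝ} {α b c : ℝ}

/-- Telescoping `P_θ^(r+1) - P_θ'^(r+1) = P_θ (P_θ^r - P_θ'^r) + (P_θ - P_θ') P_θ'^r`: each kernel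
exchanged costs `B δ`. -/
theorem AdaptiveChain.abs_iterFun_sub_le {h : X → ℝ} (hh : Measurable h) {B δ : ℝ}
    (hB : ∀ y, |h y| ≤ B) (hδ : 0 ≤ δ) {θ θ' : Θ} (hD : M.D θ θ' ≤ ENNReal.ofReal δ) (r : ℕ)
    (x : X) : |M.iterFun h r (x, θ) - M.iterFun h r (x, θ')| ≤ r * (B * δ) := by
  induction r generalizing x with
  | zero => simp [AdaptiveChain.iterFun]
  | succ r ih =>
    have hm : ∀ θ : Θ, Measurable fun y => M.iterFun h r (y, θ) := fun θ =>
      (M.measurable_iterFun hh r).comp (by fun_prop)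
    have hi : ∀ θ θ₁ : Θ, Integrable (fun y => M.iterFun h r (y, θ)) (M.P θ₁ x) := fun θ θ₁ =>
      integrable_of_abs_le _ (hm θ) fun y => M.abs_iterFun_le hB r (y, θ)
    have h1 : |∫ y, M.iterFun h r (y, θ) - M.iterFun h r (y, θ') ∂(M.P θ x)| ≤ r * (B * δ) :=
      abs_integral_le_of_abs_le _ ih
    rw [integral_sub (hi θ θ) (hi θ' θ)] at h1
    have h2 := abs_integral_sub_le_of_wDist_le (W := fun _ => 1) (μ := M.P θ x) (ν := M.P θ' x)
      (fun _ => le_rfl) (hm θ') (fun y => M.abs_iterFun_le hB r (y, θ')) hδ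
      ((le_iSup (fun x => wDist (fun _ => 1) (M.P θ x) (M.P θ' x)) x).trans hD)
    rw [M.iterFun_succ, M.iterFun_succ]
    push_cast
    have h3 := abs_sub_le (∫ y, M.iterFun h r (y, θ) ∂(M.P θ x))
      (∫ y, M.iterFun h r (y, θ') ∂(M.P θ x)) (∫ y, M.iterFun h r (y, θ') ∂(M.P θ' x))
    linarith

theorem AdaptiveChain.integral_law_eval (M : AdaptiveChain X Θ) (l k : ℕ) (z : X × Θ)
    {g : X × Θ → ℝ} (hg : Measurable g) :
    ∫ ω, g (ω k) ∂(M.law l z) = ∫ z', g z' ∂(M.nStep l k z) := by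
  rw [← M.law_map_eval, integral_map (measurable_pi_apply k).aemeasurable hg.aestronglyMeasurable]

theorem AdaptiveChain.integral_iterFun_succ {h : X → ℝ} (hh : Measurable h) {B : ℝ}
    (hB : ∀ y, |h y| ≤ B) (r l k : ℕ) (z : X × Θ) :
    ∫ z', M.iterFun h (r + 1) z' ∂(M.nStep l k z) =
      ∫ ω, M.iterFun h r ((ω (k + 1)).1, (ω k).2) ∂(M.law l z) := by
  have hm : Measurable fun p : (X × Θ) × (X × Θ) => M.iterFun h r (p.2.1, p.1.2) :=
    (M.measurable_iterFun hh r).comp (by fun_prop)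
  have h1 : ∫ ω, M.iterFun h r ((ω (k + 1)).1, (ω k).2) ∂(M.law l z) =
      ∫ p : (X × Θ) × (X × Θ), M.iterFun h r (p.2.1, p.1.2)
        ∂((M.law l z).map (fun ω => (ω k, ω (k + 1)))) := by
    rw [integral_map (by fun_prop) hm.aestronglyMeasurable]
  rw [h1, M.law_map_pair, M.law_map_eval, Measure.integral_compProd
    (integrable_of_abs_le _ hm fun p => M.abs_iterFun_le hB r (p.2.1, p.1.2))]
  refine integral_congr_ae (Eventually.of_forall fun z' => ?_)
  have h2 : Measurable fun y => M.iterFun h r (y, z'.2) :=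
    (M.measurable_iterFun hh r).comp (by fun_prop)
  exact (M.integral_Pbar_fst (l + k) z'.1 z'.2 h2).symm

/-- One application of the kernel with the current parameter is a real step of the chain. What
remains is to update that parameter in the other `r` applications, which is cheap unless the
parameter moved by at least `δ`. -/
theorem AdaptiveChain.abs_integral_iterFun_succ_sub_le {h : X → ℝ} (hh : Measurable h) {B δ : ℝ}
    (hB : ∀ y, |h y| ≤ B) (hδ : 0 ≤ δ) (r l k : ℕ) (z : X × Θ) :
    |∫ z', M.iterFun h (r + 1) z' ∂(M.nStep l k z) -
      ∫ z', M.iterFun h r z' ∂(M.nStep l (k + 1) z)| ≤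
      r * (B * δ) +
        2 * B * (M.law l z).real {ω | ENNReal.ofReal δ ≤ M.D (ω (k + 1)).2 (ω k).2} := by
  set S := {ω : ℕ → X × Θ | ENNReal.ofReal δ ≤ M.D (ω (k + 1)).2 (ω k).2} with hS
  -- `M.D` is a supremum over all of `X`, so `S` need not be measurable; its measurable hull has the
  -- same mass.
  set T := toMeasurable (M.law l z) S with hT
  have hTm : MeasurableSet T := measurableSet_toMeasurable _ _
  have hφ := M.measurable_iterFun hh r
  have hm1 : Measurable fun ω : ℕ → X × Θ => M.iterFun h r ((ω (k + 1)).1, (ω k).2) :=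
    hφ.comp (by fun_prop)
  have hm2 : Measurable fun ω : ℕ → X × Θ => M.iterFun h r (ω (k + 1)) := hφ.comp (by fun_prop)
  have hB0 : 0 ≤ B := (abs_nonneg _).trans (hB z.1)
  have hle : ∀ ω : ℕ → X × Θ,
      ‖M.iterFun h r ((ω (k + 1)).1, (ω k).2) - M.iterFun h r (ω (k + 1))‖ ≤
        r * (B * δ) + T.indicator (fun _ => 2 * B) ω := by
    intro ω
    rw [Real.norm_eq_abs]
    by_cases hω : ω ∈ T
    · rw [indicator_of_mem hω]
      have h1 := abs_sub (M.iterFun h r ((ω (k + 1)).1, (ω k).2)) (M.iterFun h r (ω (k + 1)))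
      have h2 := M.abs_iterFun_le hB r ((ω (k + 1)).1, (ω k).2)
      have h3 := M.abs_iterFun_le hB r (ω (k + 1))
      have h4 : 0 ≤ (r : ℝ) * (B * δ) := by positivity
      linarith
    · rw [indicator_of_notMem hω, add_zero, abs_sub_comm]
      have hω' : ω ∉ S := fun h => hω (subset_toMeasurable _ _ h)
      exact M.abs_iterFun_sub_le hh hB hδ (not_le.1 hω').le r _
  have hTi : Integrable (fun ω => r * (B * δ) + T.indicator (fun _ => 2 * B) ω) (M.law l z) :=
    (integrable_const _).add ((integrable_const _).indicator hTm)
  rw [M.integral_iterFun_succ hh hB, ← M.integral_law_eval l (k + 1) z hφ,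
    ← integral_sub (integrable_of_abs_le _ hm1 fun ω => M.abs_iterFun_le hB r _)
      (integrable_of_abs_le _ hm2 fun ω => M.abs_iterFun_le hB r _)]
  refine (norm_integral_le_of_norm_le hTi (Eventually.of_forall hle)).trans_eq ?_
  rw [integral_add (integrable_const _) ((integrable_const _).indicator hTm),
    integral_indicator_const _ hTm, hT, measureReal_def, measure_toMeasurable, ← measureReal_def]
  simp [mul_comm]

theorem AdaptiveChain.abs_integral_iterFun_sub_le {h : X → ℝ} (hh : Measurable h) {B δ ρ : ℝ}
    (hB : ∀ y, |h y| ≤ B) (hδ : 0 ≤ δ) {l k₀ : ℕ} {z : X × Θ}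
    (hρ : ∀ k, k₀ ≤ k →
      (M.law l z).real {ω | ENNReal.ofReal δ ≤ M.D (ω (k + 1)).2 (ω k).2} ≤ ρ) (n m : ℕ)
    (hm : k₀ ≤ m) :
    |∫ z', M.iterFun h n z' ∂(M.nStep l m z) - ∫ z', h z'.1 ∂(M.nStep l (m + n) z)| ≤
      B * (n * (n * δ + 2 * ρ)) := by
  have hB0 : 0 ≤ B := (abs_nonneg _).trans (hB z.1)
  have hρ0 : 0 ≤ ρ := measureReal_nonneg.trans (hρ k₀ le_rfl)
  induction n generalizing m with
  | zero => simp [AdaptiveChain.iterFun]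
  | succ n ih =>
    have h1 := M.abs_integral_iterFun_succ_sub_le hh hB hδ n l m z
    have h2 := ih (m + 1) (by omega)
    have h3 := abs_sub_le (∫ z', M.iterFun h (n + 1) z' ∂(M.nStep l m z))
      (∫ z', M.iterFun h n z' ∂(M.nStep l (m + 1) z))
      (∫ z', h z'.1 ∂(M.nStep l (m + 1 + n) z))
    rw [show m + (n + 1) = m + 1 + n by ring]
    have h4 := mul_le_mul_of_nonneg_left (hρ m hm) (show 0 ≤ 2 * B by positivity)
    have h5 : 0 ≤ B * δ := by positivity
    have h6 : (0 : ℝ) ≤ n := n.cast_nonneg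
    have h7 : B * (((n + 1 : ℕ) : ℝ) * (((n + 1 : ℕ) : ℝ) * δ + 2 * ρ)) =
      B * (n * (n * δ + 2 * ρ)) + n * (B * δ) + 2 * B * ρ + (n + 1) * (B * δ) := by
      push_cast; ring
    rw [h7]
    have h8 : 0 ≤ (n + 1 : ℝ) * (B * δ) := by positivity
    linarith

theorem sum_pow_le_inv {a : ℝ} (ha : 0 < a) (ha1 : a < 1) (N : ℕ) :
    ∑ k ∈ Finset.range N, (1 - a) ^ k ≤ 1 / a := by
  rw [le_div_iff₀ ha]
  have h := geom_sum_mul_neg (1 - a) N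
  rw [sub_sub_cancel] at h
  rw [h]
  have : 0 ≤ (1 - a) ^ N := pow_nonneg (by linarith) _
  linarith

/-- A discounted sum whose terms are, after an initial stretch, controlled by the terms of two
shifts of a summable sequence. -/
theorem discounted_sum_le_of_tail {e v : ℕ → ℝ} {a A B K S : ℝ} {k₀ n : ℕ} (ha : 0 < a)
    (ha1 : a < 1) (he : ∀ j, 0 ≤ e j) (hv : ∀ j, 0 ≤ v j) (hA : 0 ≤ A) (hB : 0 ≤ B)
    (hS : ∀ N, ∑ k ∈ Finset.range N, (1 - a) ^ k * v k ≤ S)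
    (he1 : ∀ j, j < k₀ + n → e j ≤ K)
    (he2 : ∀ m, k₀ ≤ m → e (m + n) ≤ A * (v (m + n) + 2 * v m) + B) (N : ℕ) :
    ∑ j ∈ Finset.range N, (1 - a) ^ (j + 1) * e j ≤ (k₀ + n) * K + 3 * A * S + B / a := by
  have hr : 0 ≤ 1 - a := by linarith
  have hr1 : 1 - a ≤ 1 := by linarith
  have hshift : ∀ L, ∑ i ∈ Finset.range N, (1 - a) ^ (L + i) * v (L + i) ≤ S := fun L => by
    have h := hS (L + N)
    rw [Finset.sum_range_add] at h
    have h0 : 0 ≤ ∑ k ∈ Finset.range L, (1 - a) ^ k * v k :=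
      Finset.sum_nonneg fun k _ => mul_nonneg (pow_nonneg hr k) (hv k)
    linarith
  have h1 : ∑ j ∈ Finset.range N, (1 - a) ^ (j + 1) * e j ≤
      ∑ j ∈ Finset.range (k₀ + n + N), (1 - a) ^ (j + 1) * e j :=
    Finset.sum_le_sum_of_subset_of_nonneg (Finset.range_mono (by omega))
      fun j _ _ => mul_nonneg (pow_nonneg hr _) (he j)
  rw [Finset.sum_range_add] at h1
  have h2 : ∑ j ∈ Finset.range (k₀ + n), (1 - a) ^ (j + 1) * e j ≤ (k₀ + n) * K := by
    have : ∑ j ∈ Finset.range (k₀ + n), (1 - a) ^ (j + 1) * e j ≤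
        ∑ j ∈ Finset.range (k₀ + n), K := Finset.sum_le_sum fun j hj =>
      (mul_le_of_le_one_left (he j) (pow_le_one₀ hr hr1)).trans (he1 j (Finset.mem_range.1 hj))
    simpa using this
  -- The weight is lowered to a smaller exponent to match each term: the index of `v` for the two
  -- shifts, and `i` for the constant.
  have h3 : ∀ i, (1 - a) ^ (k₀ + n + i + 1) * e (k₀ + n + i) ≤
      A * ((1 - a) ^ (k₀ + n + i) * v (k₀ + n + i)) +
        2 * A * ((1 - a) ^ (k₀ + i) * v (k₀ + i)) + B * (1 - a) ^ i := by
    intro i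
    have h4 := he2 (k₀ + i) (by omega)
    rw [show k₀ + i + n = k₀ + n + i by ring] at h4
    have p0 := pow_nonneg hr (k₀ + n + i + 1)
    have p1 : (1 - a) ^ (k₀ + n + i + 1) ≤ (1 - a) ^ (k₀ + n + i) :=
      pow_le_pow_of_le_one hr hr1 (by omega)
    have p2 : (1 - a) ^ (k₀ + n + i + 1) ≤ (1 - a) ^ (k₀ + i) :=
      pow_le_pow_of_le_one hr hr1 (by omega)
    have p3 : (1 - a) ^ (k₀ + n + i + 1) ≤ (1 - a) ^ i :=
      pow_le_pow_of_le_one hr hr1 (by omega)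
    have q1 := mul_le_mul_of_nonneg_right p1 (mul_nonneg hA (hv (k₀ + n + i)))
    have q2 := mul_le_mul_of_nonneg_right p2
      (mul_nonneg (mul_nonneg zero_le_two hA) (hv (k₀ + i)))
    have q3 := mul_le_mul_of_nonneg_right p3 hB
    have q4 := mul_le_mul_of_nonneg_left h4 p0
    linarith
  have h5 : ∑ i ∈ Finset.range N, (1 - a) ^ (k₀ + n + i + 1) * e (k₀ + n + i) ≤
      A * S + 2 * A * S + B * (1 / a) := by
    refine (Finset.sum_le_sum fun i _ => h3 i).trans ?_
    rw [Finset.sum_add_distrib, Finset.sum_add_distrib, ← Finset.mul_sum, ← Finset.mul_sum,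
      ← Finset.mul_sum]
    gcongr
    · exact hshift (k₀ + n)
    · exact hshift k₀
    · exact sum_pow_le_inv ha ha1 N
  have : B * (1 / a) = B / a := by ring
  linarith

end

/-! ### Resolvent sums started from a level set. -/

section
variable {X Θ : Type*} [MeasurableSpace X] [MeasurableSpace Θ] {M : AdaptiveChain X Θ}
  {C : Set X} {V : X → ℝ} {α b c : ℝ}

theorem AdaptiveChain.LevelSetErgodic.eventually_wDist_le {β₀ : ℝ} {π : Measure X}
    (herg : M.LevelSetErgodic V β₀ π) (d : ℝ) {δ : ℝ} (hδ : 0 < δ) :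
    ∀ᶠ n : ℕ in atTop, ∀ x θ, V x ≤ d →
      wDist (fun y => V y ^ β₀) ((M.P θ ^ n) x) π ≤ ENNReal.ofReal δ := by
  filter_upwards [(herg d).eventually_lt_const (ENNReal.ofReal_pos.2 hδ)] with n hn x θ hx
  refine le_trans ?_ hn.le
  exact le_iSup_of_le x (le_iSup_of_le (show x ∈ {x | V x ≤ d} from hx)
    (le_iSup (fun θ => wDist (fun y => V y ^ β₀) ((M.P θ ^ n) x) π) θ))

theorem AdaptiveChain.DiminishingAdaptation.eventually_law_le
    (hdim : M.DiminishingAdaptation V) (d : ℝ) {δ ρ : ℝ} (hδ : 0 < δ) (hρ : 0 < ρ) :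
    ∀ᶠ n : ℕ in atTop, ∀ l x θ, V x ≤ d →
      (M.law l (x, θ)).real {ω | ENNReal.ofReal δ ≤ M.D (ω (n + 1)).2 (ω n).2} ≤ ρ := by
  filter_upwards [(hdim d δ hδ).eventually_lt_const (ENNReal.ofReal_pos.2 hρ)] with n hn l x θ hx
  refine ENNReal.toReal_le_of_le_ofReal hρ.le (le_trans ?_ hn.le)
  exact le_iSup_of_le l (le_iSup_of_le x (le_iSup_of_le (show x ∈ {x | V x ≤ d} from hx)
    (le_iSup (fun θ => M.law l (x, θ)
      {ω | ENNReal.ofReal δ ≤ M.D (ω (n + 1)).2 (ω n).2}) θ)))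

theorem AdaptiveChain.Drift.lintegral_target_le (hdrift : M.Drift C V α b c)
    (hVm : Measurable V) (hV : ∀ x, 1 ≤ V x) (hα : 0 ≤ α) (hb : 0 ≤ b) (hc : 0 < c)
    {β₀ : ℝ} (hβ₀ : 0 ≤ β₀) {π : Measure X} [IsProbabilityMeasure π]
    (herg : M.LevelSetErgodic V β₀ π) (x : X) (θ : Θ) :
    ∫⁻ y, ENNReal.ofReal (V y ^ (1 - α)) ∂π ≤ ENNReal.ofReal (b / c) := by
  refine hdrift.lintegral_stationary_le hVm hV hα hb hc θ x fun g hg ⟨B, hB⟩ => ?_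
  rw [Metric.tendsto_atTop]
  intro r hr
  have hB0 : 0 ≤ B := (abs_nonneg _).trans (hB x)
  have hδ : 0 < r / (2 * (B + 1)) := by positivity
  obtain ⟨N, hN⟩ := eventually_atTop.1 (herg.eventually_wDist_le (V x) hδ)
  refine ⟨N, fun n hn => ?_⟩
  rw [Real.dist_eq]
  refine (abs_integral_sub_le_of_wDist_le (fun y => Real.one_le_rpow (hV y) hβ₀) hg hB hδ.le
    (hN n hn x θ le_rfl)).trans_lt ?_
  rw [← mul_div_assoc, div_lt_iff₀ (by positivity)]
  nlinarith

theorem rpow_le_mul_rpow_of_le {v d β p : ℝ} (hd : 0 < d) (hv : d ≤ v) (hβp : β ≤ p) :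
    v ^ β ≤ d ^ (β - p) * v ^ p := by
  have hv0 : 0 < v := hd.trans_le hv
  calc v ^ β = v ^ (β - p) * v ^ p := by rw [← Real.rpow_add hv0]; congr 1; ring
    _ ≤ _ := by
      gcongr ?_ * _
      exact Real.rpow_le_rpow_of_nonpos hd hv (by linarith)

/-- Quantitative mixing of the adaptive chain after truncation at level `d`. -/
theorem AdaptiveChain.Drift.abs_integral_nStep_le (hdrift : M.Drift C V α b c)
    (hVm : Measurable V) (hV : ∀ x, 1 ≤ V x) (hα : 0 ≤ α) (hb : 0 ≤ b)
    {β β₀ : ℝ} (hβ : 0 ≤ β) (hβ' : β < 1 - α) (hβ₀ : 0 ≤ β₀)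
    {π : Measure X} [IsProbabilityMeasure π]
    (hπ : ∫⁻ y, ENNReal.ofReal (V y ^ (1 - α)) ∂π ≤ ENNReal.ofReal (b / c)) (hc : 0 ≤ c)
    {d ε δ ρ : ℝ} {n k₀ l : ℕ} {z : X × Θ} (hd : 1 ≤ d) (hε : 0 ≤ ε) (hδ : 0 ≤ δ)
    (hmix : ∀ x θ, V x ≤ d → wDist (fun y => V y ^ β₀) ((M.P θ ^ n) x) π ≤ ENNReal.ofReal ε)
    (hρ : ∀ k, k₀ ≤ k →
      (M.law l z).real {ω | ENNReal.ofReal δ ≤ M.D (ω (k + 1)).2 (ω k).2} ≤ ρ)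
    {h : X → ℝ} (hh : Measurable h) {w : ℝ} (hw : 0 ≤ w) (hhw : ∀ x, |h x| ≤ w * V x ^ β)
    (hh0 : ∫ y, h y ∂π = 0) {m : ℕ} (hm : k₀ ≤ m) :
    |∫ z', h z'.1 ∂(M.nStep l (m + n) z)| ≤
      w * d ^ (β - (1 - α)) * (∫ z', V z'.1 ^ (1 - α) ∂(M.nStep l (m + n) z) +
        2 * ∫ z', V z'.1 ^ (1 - α) ∂(M.nStep l m z)) +
      w * (d ^ (β - (1 - α)) * (b / c) + d ^ β * (ε + n * (n * δ + 2 * ρ))) := by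
  set p := 1 - α with hp
  set η := d ^ (β - p) with hη
  have hd0 : 0 < d := by linarith
  have hη0 : 0 ≤ η := Real.rpow_nonneg hd0.le _
  have hV0 : ∀ x, 0 < V x := fun x => zero_lt_one.trans_le (hV x)
  have hVp : ∀ x, 0 ≤ V x ^ p := fun x => Real.rpow_nonneg (hV0 x).le _
  have hLm : MeasurableSet {x | V x ≤ d} := hVm measurableSet_Iic
  set h₁ := {x | V x ≤ d}.indicator h with hh₁
  have hh₁m : Measurable h₁ := hh.indicator hLm
  set B := w * d ^ β with hBdef
  have hdβ : 0 ≤ d ^ β := Real.rpow_nonneg hd0.le _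
  have hB0 : 0 ≤ B := mul_nonneg hw hdβ
  have hB : ∀ y, |h₁ y| ≤ B := by
    intro y
    by_cases hy : V y ≤ d
    · rw [hh₁, indicator_of_mem (show y ∈ {x | V x ≤ d} from hy)]
      exact (hhw y).trans (mul_le_mul_of_nonneg_left
        (Real.rpow_le_rpow (hV0 y).le hy hβ) hw)
    · rw [hh₁, indicator_of_notMem (show y ∉ {x | V x ≤ d} from hy), abs_zero]
      exact hB0
  have htail : ∀ y, |h y - h₁ y| ≤ w * η * V y ^ p := by
    intro y
    by_cases hy : V y ≤ d
    · rw [hh₁, indicator_of_mem (show y ∈ {x | V x ≤ d} from hy), sub_self, abs_zero]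
      exact mul_nonneg (mul_nonneg hw hη0) (hVp y)
    · rw [hh₁, indicator_of_notMem (show y ∉ {x | V x ≤ d} from hy), sub_zero]
      refine (hhw y).trans ?_
      rw [mul_assoc]
      exact mul_le_mul_of_nonneg_left
        (rpow_le_mul_rpow_of_le hd0 (not_le.1 hy).le hβ'.le) hw
  -- the tail under a probability measure
  have hcmp : ∀ (μ : Measure X) [IsProbabilityMeasure μ], Integrable (fun y => V y ^ p) μ →
      |∫ y, h y ∂μ - ∫ y, h₁ y ∂μ| ≤ w * η * ∫ y, V y ^ p ∂μ := by
    intro μ _ hi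
    have hhi : Integrable h μ := (hi.const_mul w).mono' hh.aestronglyMeasurable
      (Eventually.of_forall fun y => (hhw y).trans (mul_le_mul_of_nonneg_left
        (Real.rpow_le_rpow_of_exponent_le (hV y) hβ'.le) hw))
    rw [← integral_sub hhi (integrable_of_abs_le μ hh₁m hB), ← integral_const_mul]
    exact abs_integral_le_integral (hi.const_mul _) htail
  have hπi : Integrable (fun y => V y ^ p) π :=
    integrable_of_lintegral_ofReal_le (hVm.pow_const p) hVp hπ
  have hbc : 0 ≤ b / c := div_nonneg hb hc
  have hπ1 : |∫ y, h₁ y ∂π| ≤ w * η * (b / c) := by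
    have h1 := hcmp π hπi
    rw [hh0, zero_sub, abs_neg] at h1
    exact h1.trans (mul_le_mul_of_nonneg_left
      (integral_le_of_lintegral_ofReal_le (hVm.pow_const p) hVp hbc hπ) (mul_nonneg hw hη0))
  -- Inside the level set ergodicity gives closeness to the small number `π(h₁)`. Outside, the
  -- trivial bound `B` is itself at most `w * η * V ^ p`.
  have hφ : ∀ z' : X × Θ, |M.iterFun h₁ n z'| ≤
      w * η * (b / c) + B * ε + 2 * (w * η) * V z'.1 ^ p := by
    rintro ⟨x, θ⟩
    have h0 : 0 ≤ w * η * V x ^ p := mul_nonneg (mul_nonneg hw hη0) (hVp x)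
    by_cases hx : V x ≤ d
    · rw [M.iterFun_eq hh₁m hB]
      have h1 := abs_integral_sub_le_of_wDist_le (μ := (M.P θ ^ n) x)
        (fun y => Real.one_le_rpow (hV y) hβ₀) hh₁m hB hε (hmix x θ hx)
      have h2 := abs_sub_abs_le_abs_sub (∫ y, h₁ y ∂((M.P θ ^ n) x)) (∫ y, h₁ y ∂π)
      simp only
      linarith
    · have h1 := M.abs_iterFun_le hB n (x, θ)
      have h2 : d ^ β ≤ η * V x ^ p :=
        (Real.rpow_le_rpow hd0.le (not_le.1 hx).le hβ).trans
          (rpow_le_mul_rpow_of_le hd0 (not_le.1 hx).le hβ'.le)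
      have h3 : B ≤ w * η * V x ^ p := by
        rw [mul_assoc]; exact mul_le_mul_of_nonneg_left h2 hw
      have h4 : 0 ≤ w * η * (b / c) := mul_nonneg (mul_nonneg hw hη0) hbc
      have h5 : 0 ≤ B * ε := mul_nonneg hB0 hε
      simp only
      linarith
  have hvi : ∀ k, Integrable (fun z' : X × Θ => V z'.1 ^ p) (M.nStep l k z) := fun k =>
    hdrift.integrable_rpow_nStep hVm hV hα hb (by linarith) l k z
  have hφi : |∫ z', M.iterFun h₁ n z' ∂(M.nStep l m z)| ≤
      w * η * (b / c) + B * ε + 2 * (w * η) * ∫ z', V z'.1 ^ p ∂(M.nStep l m z) := by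
    have hi2 : Integrable (fun z' : X × Θ => 2 * (w * η) * V z'.1 ^ p) (M.nStep l m z) :=
      (hvi m).const_mul _
    refine (abs_integral_le_integral ((integrable_const (w * η * (b / c) + B * ε)).add hi2)
      hφ).trans_eq ?_
    rw [integral_add' (integrable_const _) hi2, integral_const_mul]
    simp
  have hadapt := M.abs_integral_iterFun_sub_le hh₁m hB hδ hρ n m hm
  have htr : |∫ z', h z'.1 ∂(M.nStep l (m + n) z) - ∫ z', h₁ z'.1 ∂(M.nStep l (m + n) z)| ≤
      w * η * ∫ z', V z'.1 ^ p ∂(M.nStep l (m + n) z) := by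
    have : IsProbabilityMeasure ((M.nStep l (m + n) z).map Prod.fst) :=
      Measure.isProbabilityMeasure_map measurable_fst.aemeasurable
    have h1 := hcmp ((M.nStep l (m + n) z).map Prod.fst)
      ((integrable_map_measure (hVm.pow_const p).aestronglyMeasurable
        measurable_fst.aemeasurable).2 (hvi (m + n)))
    rwa [integral_map measurable_fst.aemeasurable hh.aestronglyMeasurable,
      integral_map measurable_fst.aemeasurable hh₁m.aestronglyMeasurable,
      integral_map measurable_fst.aemeasurable (hVm.pow_const p).aestronglyMeasurable] at h1
  rw [abs_le] at *
  have e1 : w * (η * (b / c) + d ^ β * (ε + n * (n * δ + 2 * ρ))) =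
    w * η * (b / c) + B * ε + B * (n * (n * δ + 2 * ρ)) := by rw [hBdef]; ring
  rw [e1]
  constructor <;> linarith [htr.1, htr.2, hadapt.1, hadapt.2, hφi.1, hφi.2]

/-- The resolvent sums started from a level set are at most `2 ε / a` up to an additive constant. -/
theorem AdaptiveChain.Drift.exists_levelSet_bound (hdrift : M.Drift C V α b c)
    (hVm : Measurable V) (hV : ∀ x, 1 ≤ V x) (hα : 0 ≤ α) (hb : 0 ≤ b) (hc : 0 < c)
    {β β₀ : ℝ} (hβ : 0 ≤ β) (hβ' : β < 1 - α) (hβ₀ : 0 ≤ β₀)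
    {π : Measure X} [IsProbabilityMeasure π]
    (herg : M.LevelSetErgodic V β₀ π) (hdim : M.DiminishingAdaptation V)
    (d : ℝ) {ε : ℝ} (hε : 0 < ε) :
    ∃ n : ℕ, 2 ≤ n ∧ ∃ K : ℝ, 0 ≤ K ∧ ∀ a : ℝ, 0 < a → a < 1 → ∀ h : X → ℝ, Measurable h →
      ∀ w : ℝ, 0 ≤ w → (∀ x, |h x| ≤ w * V x ^ β) → ∫ y, h y ∂π = 0 →
      ∀ (l : ℕ) (x : X) (θ : Θ), V x ≤ d → ∀ N : ℕ,
        ∑ j ∈ Finset.range N, (1 - a) ^ (j + 1) * |∫ z', h z'.1 ∂(M.nStep l j (x, θ))| ≤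
          w * (2 * ε / a + K) := by
  set p := 1 - α with hp
  -- Of the four copies of `b / c`, three come from the discounted sums of `V ^ p` along the chain
  -- and one from its `π`-mean.
  obtain ⟨d', hd', hη⟩ : ∃ d' : ℝ, 1 ≤ d' ∧ d' ^ (β - p) * (4 * (b / c)) ≤ ε := by
    have ht : Tendsto (fun y : ℝ => y ^ (β - p) * (4 * (b / c))) atTop (𝓝 0) := by
      have := (tendsto_rpow_neg_atTop (show 0 < p - β by linarith)).mul_const (4 * (b / c))
      simpa only [neg_sub, zero_mul] using this
    obtain ⟨y, hy⟩ := ((ht.eventually_lt_const hε).and (eventually_ge_atTop 1)).exists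
    exact ⟨y, hy.2, hy.1.le⟩
  set η := d' ^ (β - p) with hηdef
  have hη0 : 0 ≤ η := Real.rpow_nonneg (by linarith) _
  have hη1 : η ≤ 1 := Real.rpow_le_one_of_one_le_of_nonpos hd' (by linarith)
  set B := d' ^ β with hBdef
  have hB1 : 1 ≤ B := Real.one_le_rpow hd' hβ
  have hB0 : 0 < B := by linarith
  set ε₁ := ε / (2 * B) with hε₁
  have hε₁0 : 0 < ε₁ := by positivity
  obtain ⟨n, hn2, hmix⟩ : ∃ n : ℕ, 2 ≤ n ∧ ∀ x θ, V x ≤ d' →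
      wDist (fun y => V y ^ β₀) ((M.P θ ^ n) x) π ≤ ENNReal.ofReal ε₁ := by
    obtain ⟨n, hn⟩ := ((eventually_ge_atTop 2).and
      (herg.eventually_wDist_le d' hε₁0)).exists
    exact ⟨n, hn.1, hn.2⟩
  have hn0 : (0 : ℝ) < n := by exact_mod_cast (by omega : 0 < n)
  set δ := ε / (4 * B * n * n) with hδdef
  have hδ0 : 0 < δ := by positivity
  set ρ := ε / (8 * B * n) with hρdef
  have hρ0 : 0 < ρ := by positivity
  -- The shares are `ε / 2` for mixing, `ε / 4` for small parameter moves and `ε / 4` for large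
  -- ones.
  have hεsum : B * (ε₁ + n * (n * δ + 2 * ρ)) = ε := by
    rw [hε₁, hδdef, hρdef]; field_simp; ring
  obtain ⟨k₀, hk₀⟩ := eventually_atTop.1 (hdim.eventually_law_le d hδ0 hρ0)
  set D := max d 1 with hD
  have hD0 : 0 < D := lt_max_of_lt_right one_pos
  have hbc : 0 ≤ b / c := div_nonneg hb hc.le
  -- The first summand pays for the `k₀ + n` initial terms, estimated by the linear growth of `E V`;
  -- the second is the starting value of `V` in the discounted drift sums.
  refine ⟨n, hn2, (k₀ + n) * (D + b * (k₀ + n)) + 3 * (D / c), by positivity, ?_⟩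
  intro a ha ha1 h hh w hw hhw hh0 l x θ hx N
  have hπ := hdrift.lintegral_target_le hVm hV hα hb hc hβ₀ herg x θ
  set v : ℕ → ℝ := fun k => ∫ z', V z'.1 ^ p ∂(M.nStep l k (x, θ)) with hv
  have hv0 : ∀ k, 0 ≤ v k := fun k =>
    integral_nonneg fun z' => Real.rpow_nonneg (zero_le_one.trans (hV z'.1)) _
  have hS : ∀ N, ∑ k ∈ Finset.range N, (1 - a) ^ k * v k ≤ (D + b / a) / c := by
    intro N
    rw [le_div_iff₀' hc]
    refine (hdrift.discounted_sum_le hVm hV hα hb (by linarith : 0 ≤ 1 - a) (by linarith)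
      l N (x, θ)).trans ?_
    have h1 := mul_le_mul_of_nonneg_left (sum_pow_le_inv ha ha1 N) hb
    rw [mul_one_div] at h1
    exact add_le_add (hx.trans (le_max_left _ _)) h1
  have hmain := discounted_sum_le_of_tail
    (e := fun j => |∫ z', h z'.1 ∂(M.nStep l j (x, θ))|) (v := v) (a := a) (A := w * η)
    (B := w * (η * (b / c) + ε)) (K := w * (D + b * (k₀ + n))) (S := (D + b / a) / c)
    (k₀ := k₀) (n := n) ha ha1 (fun j => abs_nonneg _) hv0 (by positivity) (by positivity) hS
    ?_ ?_ N
  · refine hmain.trans ?_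
    have h1 : (k₀ + n) * (w * (D + b * (k₀ + n))) + 3 * (w * η) * ((D + b / a) / c) +
        w * (η * (b / c) + ε) / a = w * ((η * (4 * (b / c)) + ε) / a +
          ((k₀ + n) * (D + b * (k₀ + n)) + η * (3 * (D / c)))) := by
      field_simp; ring
    rw [h1]
    have h2 : η * (3 * (D / c)) ≤ 1 * (3 * (D / c)) := by gcongr
    have h3 : (η * (4 * (b / c)) + ε) / a ≤ 2 * ε / a := by gcongr; linarith
    refine mul_le_mul_of_nonneg_left ?_ hw
    linarith
  · intro j hj
    have hi := hdrift.integrable_nStep hVm hV hα hb l j (x, θ)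
    have h1 : |∫ z', h z'.1 ∂(M.nStep l j (x, θ))| ≤
        ∫ z', w * V z'.1 ∂(M.nStep l j (x, θ)) :=
      abs_integral_le_integral (hi.const_mul w) (fun z' =>
        (hhw z'.1).trans (mul_le_mul_of_nonneg_left
          (Real.rpow_le_self_of_one_le (hV z'.1) (by linarith)) hw))
    rw [integral_const_mul] at h1
    refine h1.trans (mul_le_mul_of_nonneg_left ?_ hw)
    refine (hdrift.integral_nStep_le hVm hV hα hb hc.le l j (x, θ)).trans ?_
    have h2 : (j : ℝ) ≤ k₀ + n := by exact_mod_cast hj.le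
    exact add_le_add (hx.trans (le_max_left _ _)) (mul_le_mul_of_nonneg_left h2 hb)
  · intro m hm
    have := hdrift.abs_integral_nStep_le hVm hV hα hb hβ hβ' hβ₀ hπ hc.le hd' hε₁0.le hδ0.le
      hmix (fun k hk => hk₀ k hk l x θ hx) hh hw hhw hh0 hm
    rwa [hεsum] at this

end

/-! ### Extension from a level set to the whole space. -/

section
theorem rpow_interpolation {v a α β c t : ℝ} (hv : 0 < v) (ha : 0 < a) (ha1 : a < 1)
    (hα : 0 < α) (hβ : 0 ≤ β) (hc : 0 < c) (ht : 0 ≤ t) (ht1 : t ≤ 1) :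
    a ^ (1 - t) * ((1 - a) * (α * c)) ^ t * v ^ β ≤
      a * v ^ (β + α * t) + (1 - a) * ((β + α * t) * c * v ^ (β + α * t - α)) := by
  have ha' : 0 < 1 - a := by linarith
  set s := β + α * t with hs
  -- The exponents combine as `s * (1 - t) + (s - α) * t = β`. The weight `t` on the second term is
  -- affordable since `s ≥ α * t`.
  have h1 := Real.geom_mean_le_arith_mean2_weighted (w₁ := 1 - t) (w₂ := t) (p₁ := a * v ^ s)
    (p₂ := (1 - a) * (α * c) * v ^ (s - α)) (by linarith) ht (by positivity) (by positivity)
    (by ring)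
  rw [Real.mul_rpow ha.le (by positivity), Real.mul_rpow (by positivity) (by positivity),
    ← Real.rpow_mul hv.le, ← Real.rpow_mul hv.le] at h1
  have h2 : v ^ β = v ^ (s * (1 - t)) * v ^ ((s - α) * t) := by
    rw [← Real.rpow_add hv]; congr 1; rw [hs]; ring
  have h3 : t * ((1 - a) * (α * c) * v ^ (s - α)) ≤ (1 - a) * (s * c * v ^ (s - α)) := by
    have h4 : 0 ≤ β * ((1 - a) * c * v ^ (s - α)) := by positivity
    have h5 : (1 - a) * (s * c * v ^ (s - α)) = t * ((1 - a) * (α * c) * v ^ (s - α)) +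
      β * ((1 - a) * c * v ^ (s - α)) := by rw [hs]; ring
    linarith
  have h6 : (1 - t) * (a * v ^ s) ≤ a * v ^ s :=
    mul_le_of_le_one_left (by positivity) (by linarith)
  rw [h2]
  calc _ = a ^ (1 - t) * v ^ (s * (1 - t)) *
        (((1 - a) * (α * c)) ^ t * v ^ ((s - α) * t)) := by ring
    _ ≤ _ := by linarith

variable {X Θ : Type*} [MeasurableSpace X] [MeasurableSpace Θ] {M : AdaptiveChain X Θ}
  {C : Set X} {V : X → ℝ} {α b c : ℝ}

theorem AdaptiveChain.Minorization.mul_le_real {ν : Measure X} [IsProbabilityMeasure ν] {ε₀ : ℝ}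
    (hε₀ : 0 ≤ ε₀) (hmin : M.Minorization C ε₀ ν) (θ : Θ) {x : X} (hx : x ∈ C) (A : Set X) :
    ε₀ * ν.real A ≤ (M.P θ x).real A := by
  have h := hmin θ x hx A
  rw [Measure.smul_apply, smul_eq_mul] at h
  have h2 := ENNReal.toReal_mono (measure_ne_top _ _) h
  rwa [ENNReal.toReal_mul, ENNReal.toReal_ofReal hε₀] at h2

/-- First-step decomposition. The remaining chain starts at epoch `l + 1`, which is why all bounds
must be uniform in the epoch. -/
theorem AdaptiveChain.Drift.integral_nStep_succ (hdrift : M.Drift C V α b c)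
    (hVm : Measurable V) (hV : ∀ x, 1 ≤ V x) (hα : 0 ≤ α) (hb : 0 ≤ b) {h : X → ℝ}
    (hh : Measurable h) {w : ℝ} (hhw : ∀ x, |h x| ≤ w * V x) (l j : ℕ) (z : X × Θ) :
    ∫ z', h z'.1 ∂(M.nStep l (j + 1) z) =
      ∫ z', (∫ z'', h z''.1 ∂(M.nStep (l + 1) j z')) ∂(M.Pbar l z) := by
  have hi : Integrable (fun z' : X × Θ => h z'.1) (M.nStep l (j + 1) z) :=
    ((hdrift.integrable_nStep hVm hV hα hb l (j + 1) z).const_mul w).mono'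
      (hh.comp measurable_fst).aestronglyMeasurable (Eventually.of_forall fun z' => hhw z'.1)
  rw [M.nStep_succ'] at hi ⊢
  exact Kernel.integral_comp hi

theorem AdaptiveChain.Drift.integrable_integral_nStep (hdrift : M.Drift C V α b c)
    (hVm : Measurable V) (hV : ∀ x, 1 ≤ V x) (hα : 0 ≤ α) (hb : 0 ≤ b) (hc : 0 ≤ c) {h : X → ℝ}
    (hh : Measurable h) {w : ℝ} (hw : 0 ≤ w) (hhw : ∀ x, |h x| ≤ w * V x) (l j n : ℕ)
    (z : X × Θ) :
    Integrable (fun z' => ∫ z'', h z''.1 ∂(M.nStep l j z')) (M.Pbar n z) := by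
  have hVi : Integrable (fun z' : X × Θ => V z'.1) (M.Pbar n z) :=
    integrable_of_lintegral_ofReal_le (hVm.comp measurable_fst)
      (fun z' => zero_le_one.trans (hV z'.1)) (hdrift.lintegral_Pbar_le hVm hb n z)
  refine ((hVi.add (integrable_const (b * j))).const_mul w).mono'
    ((hh.comp measurable_fst).stronglyMeasurable.integral_kernel).aestronglyMeasurable
    (Eventually.of_forall fun z' => ?_)
  have h1 := abs_integral_le_integral
    ((hdrift.integrable_nStep hVm hV hα hb l j z').const_mul w) (fun z'' => hhw z''.1)
  rw [integral_const_mul] at h1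
  exact h1.trans (mul_le_mul_of_nonneg_left
    (hdrift.integral_nStep_le hVm hV hα hb hc l j z') hw)

/-- A bound for resolvent sums on a level set of `V` extends to the whole space: `V ^ s` plus a
multiple of the indicator of the complement of the level set is a supersolution. -/
theorem AdaptiveChain.Drift.discounted_sum_le_of_levelSet (hdrift : M.Drift C V α b c)
    (hVm : Measurable V) (hV : ∀ x, 1 ≤ V x) (hα : 0 < α) (hb : 0 ≤ b) (hc : 0 < c)
    {ν : Measure X} [IsProbabilityMeasure ν] {ε₀ : ℝ} (hε₀ : 0 < ε₀)
    (hmin : M.Minorization C ε₀ ν) {d : ℝ} (hd : 0 < ν {y | V y ≤ d})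
    {β t a w M₀ : ℝ} (hβ : 0 ≤ β) (hβ' : β < 1 - α) (ht : 0 ≤ t) (ht1 : t ≤ 1)
    (ha : 0 < a) (ha1 : a < 1) (hw : 0 ≤ w) (hM₀ : 0 ≤ M₀) {h : X → ℝ} (hh : Measurable h)
    (hhw : ∀ x, |h x| ≤ w * V x ^ β)
    (hD : ∀ (l : ℕ) (x : X) (θ : Θ), V x ≤ d → ∀ N : ℕ,
      ∑ j ∈ Finset.range N, (1 - a) ^ (j + 1) * |∫ z', h z'.1 ∂(M.nStep l j (x, θ))| ≤ M₀)
    (N l : ℕ) (x : X) (θ : Θ) :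
    ∑ j ∈ Finset.range N, (1 - a) ^ (j + 1) * |∫ z', h z'.1 ∂(M.nStep l j (x, θ))| ≤
      M₀ + w * (a ^ (1 - t) * ((1 - a) * (α * c)) ^ t)⁻¹ *
        (V x ^ (β + α * t) + b * (ε₀ * ν.real {y | V y ≤ d})⁻¹) := by
  have ha' : 0 < 1 - a := by linarith
  set D : Set X := {y | V y ≤ d} with hDdef
  have hDm : MeasurableSet D := hVm measurableSet_Iic
  have hνD : 0 < ν.real D := ENNReal.toReal_pos hd.ne' (measure_ne_top _ _)
  set lam := (a ^ (1 - t) * ((1 - a) * (α * c)) ^ t)⁻¹ with hlam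
  have hlam0 : 0 < lam := by positivity
  set s := β + α * t with hs
  have hαt : α * t ≤ α := mul_le_of_le_one_right hα.le ht1
  have hs0 : 0 ≤ s := by positivity
  have hs1 : s ≤ 1 := by linarith
  -- Chosen so that the indicator of `Dᶜ` loses at least `b` on average in one step from a point of
  -- `C`.
  set κ := b * (ε₀ * ν.real D)⁻¹ with hκ
  have hκ0 : 0 ≤ κ := by positivity
  have hκb : κ * (ε₀ * ν.real D) = b := by rw [hκ]; field_simp
  have hVs : ∀ y, 0 ≤ V y ^ s := fun y => Real.rpow_nonneg (zero_le_one.trans (hV y)) _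
  have hhw1 : ∀ y, |h y| ≤ w * V y := fun y => (hhw y).trans
    (mul_le_mul_of_nonneg_left (Real.rpow_le_self_of_one_le (hV y) (by linarith)) hw)
  set Φ : X → ℝ := fun y => M₀ + w * lam * (V y ^ s + κ * Dᶜ.indicator 1 y) with hΦ
  have hind0 : ∀ y, 0 ≤ Dᶜ.indicator (1 : X → ℝ) y :=
    fun y => indicator_nonneg (fun _ _ => zero_le_one) y
  have hind1 : ∀ y, Dᶜ.indicator (1 : X → ℝ) y ≤ 1 :=
    fun y => indicator_le_self' (fun _ _ => zero_le_one) y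
  have hΦm : Measurable Φ := by
    have h1 : Measurable (Dᶜ.indicator (1 : X → ℝ)) := measurable_one.indicator hDm.compl
    exact measurable_const.add (((hVm.pow_const s).add (h1.const_mul κ)).const_mul (w * lam))
  have hVsi : ∀ θ x, Integrable (fun y => V y ^ s) (M.P θ x) := fun θ x =>
    integrable_rpow hVm hV (hdrift.integrable hVm hV θ x) hs1
  have hindi : ∀ θ x, Integrable (fun y => κ * Dᶜ.indicator (1 : X → ℝ) y) (M.P θ x) :=
    fun θ x => ((integrable_const (1 : ℝ)).indicator hDm.compl).const_mul κ
  have hsumi : ∀ θ x, Integrable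
      (fun y => w * lam * (V y ^ s + κ * Dᶜ.indicator 1 y)) (M.P θ x) :=
    fun θ x => ((hVsi θ x).add (hindi θ x)).const_mul _
  have hΦi : ∀ θ x, Integrable Φ (M.P θ x) := fun θ x => (integrable_const M₀).add (hsumi θ x)
  have hΦint : ∀ θ x, ∫ y, Φ y ∂(M.P θ x) =
      M₀ + w * lam * (∫ y, V y ^ s ∂(M.P θ x) + κ * (M.P θ x).real Dᶜ) := by
    intro θ x
    rw [hΦ, integral_add (integrable_const M₀) (hsumi θ x), integral_const_mul,
      integral_add (hVsi θ x) (hindi θ x), integral_const_mul, integral_indicator_one hDm.compl]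
    simp
  -- the supersolution property off the level set
  have hsuper : ∀ θ x, x ∉ D → (1 - a) * (w * V x ^ β) + (1 - a) * ∫ y, Φ y ∂(M.P θ x) ≤ Φ x := by
    intro θ x hx
    have hx1 : Dᶜ.indicator (1 : X → ℝ) x = 1 := indicator_of_mem (mem_compl hx) _
    have hcompl : (M.P θ x).real Dᶜ = 1 - (M.P θ x).real D := probReal_compl_eq_one_sub hDm
    have hCD : b * C.indicator (1 : X → ℝ) x ≤ κ * (M.P θ x).real D := by
      by_cases hxC : x ∈ C
      · rw [indicator_of_mem hxC, Pi.one_apply, mul_one, ← hκb]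
        exact mul_le_mul_of_nonneg_left (hmin.mul_le_real hε₀.le θ hxC D) hκ0
      · rw [indicator_of_notMem hxC, mul_zero]
        exact mul_nonneg hκ0 measureReal_nonneg
    have hPV := hdrift.integral_rpow_le hVm hV hb hs0 hs1 θ x
    have hint := rpow_interpolation (zero_lt_one.trans_le (hV x)) ha ha1 hα hβ hc ht ht1
    have hint2 : V x ^ β ≤
        lam * (a * V x ^ s + (1 - a) * (s * c * V x ^ (s - α))) := by
      rw [hlam, ← div_eq_inv_mul, le_div_iff₀ (by positivity)]
      linarith
    have hVβ : 0 ≤ V x ^ β := Real.rpow_nonneg (zero_le_one.trans (hV x)) _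
    rw [hΦint, hcompl, hΦ]
    simp only [hx1]
    have key : (1 - a) * (∫ y, V y ^ s ∂(M.P θ x) + κ * (1 - (M.P θ x).real D)) ≤
        V x ^ s + κ * 1 - (a * V x ^ s + (1 - a) * (s * c * V x ^ (s - α))) := by
      have h1 := mul_le_mul_of_nonneg_left hPV ha'.le
      have h2 := mul_le_mul_of_nonneg_left hCD ha'.le
      have h3 : (1 - a) * κ ≤ κ := mul_le_of_le_one_left hκ0 (by linarith)
      linarith
    have h4 := mul_le_mul_of_nonneg_left key (mul_nonneg hw hlam0.le)
    have h5 := mul_le_mul_of_nonneg_left hint2 hw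
    have h6 : (1 - a) * (w * V x ^ β) ≤ w * V x ^ β :=
      mul_le_of_le_one_left (mul_nonneg hw hVβ) (by linarith)
    have h7 : (1 - a) * M₀ ≤ M₀ := mul_le_of_le_one_left hM₀ (by linarith)
    linarith
  have hmain : ∀ N l x θ, ∑ j ∈ Finset.range N,
      (1 - a) ^ (j + 1) * |∫ z', h z'.1 ∂(M.nStep l j (x, θ))| ≤ Φ x := by
    intro N
    induction N with
    | zero =>
      intro l x θ
      have := hVs x
      have := hind0 x
      simp only [Finset.range_zero, Finset.sum_empty, hΦ]
      positivity
    | succ N ih =>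
      intro l x θ
      by_cases hx : x ∈ D
      · refine (hD l x θ hx (N + 1)).trans ?_
        have h1 : 0 ≤ w * lam * (V x ^ s + κ * Dᶜ.indicator 1 x) :=
          mul_nonneg (mul_nonneg hw hlam0.le)
            (add_nonneg (hVs x) (mul_nonneg hκ0 (hind0 x)))
        simp only [hΦ]
        linarith
      · refine le_trans ?_ (hsuper θ x hx)
        have hei : ∀ j, Integrable (fun z' => (1 - a) ^ (j + 1) *
            |∫ z'', h z''.1 ∂(M.nStep (l + 1) j z')|) (M.Pbar l (x, θ)) := fun j =>
          (hdrift.integrable_integral_nStep hVm hV hα.le hb hc.le hh hw hhw1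
            (l + 1) j l (x, θ)).abs.const_mul _
        have hΦPi : Integrable (fun z' : X × Θ => Φ z'.1) (M.Pbar l (x, θ)) := by
          have h1 := hΦi θ x
          rw [← M.Pbar_map_fst l, integrable_map_measure hΦm.aestronglyMeasurable
            measurable_fst.aemeasurable] at h1
          exact h1
        have hle : ∑ j ∈ Finset.range N, (1 - a) ^ (j + 1) *
            |∫ z', h z'.1 ∂(M.nStep l (j + 1) (x, θ))| ≤ ∫ y, Φ y ∂(M.P θ x) := by
          calc _ ≤ ∑ j ∈ Finset.range N, ∫ z', (1 - a) ^ (j + 1) *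
                |∫ z'', h z''.1 ∂(M.nStep (l + 1) j z')| ∂(M.Pbar l (x, θ)) := by
                refine Finset.sum_le_sum fun j _ => ?_
                rw [hdrift.integral_nStep_succ hVm hV hα.le hb hh hhw1, integral_const_mul]
                exact mul_le_mul_of_nonneg_left abs_integral_le_integral_abs
                  (pow_nonneg ha'.le _)
            _ = ∫ z', ∑ j ∈ Finset.range N, (1 - a) ^ (j + 1) *
                |∫ z'', h z''.1 ∂(M.nStep (l + 1) j z')| ∂(M.Pbar l (x, θ)) :=
                (integral_finsetSum _ fun j _ => hei j).symm
            _ ≤ ∫ z', Φ z'.1 ∂(M.Pbar l (x, θ)) :=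
                integral_mono (integrable_finsetSum _ fun j _ => hei j) hΦPi
                  fun z' => ih (l + 1) z'.1 z'.2
            _ = _ := M.integral_Pbar_fst l x θ hΦm
        rw [Finset.sum_range_succ', M.integral_nStep_zero l (x, θ) (g := fun z' => h z'.1)
          (hh.comp measurable_fst)]
        have h1 : ∑ j ∈ Finset.range N, (1 - a) ^ (j + 1 + 1) *
            |∫ z', h z'.1 ∂(M.nStep l (j + 1) (x, θ))| =
            (1 - a) * ∑ j ∈ Finset.range N, (1 - a) ^ (j + 1) *
            |∫ z', h z'.1 ∂(M.nStep l (j + 1) (x, θ))| := by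
          rw [Finset.mul_sum]
          exact Finset.sum_congr rfl fun j _ => by ring
        -- The term `j = 0` is the source and the others carry one extra factor `1 - a`: the left
        -- side of the supersolution inequality.
        rw [h1, zero_add, pow_one, add_comm]
        exact add_le_add (mul_le_mul_of_nonneg_left (hhw x) ha'.le)
          (mul_le_mul_of_nonneg_left hle ha'.le)
  refine (hmain N l x θ).trans ?_
  have h1 : κ * Dᶜ.indicator 1 x ≤ κ * 1 := mul_le_mul_of_nonneg_left (hind1 x) hκ0
  have h2 : V x ^ s + κ * Dᶜ.indicator 1 x ≤ V x ^ s + κ := by linarith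
  have h3 := mul_le_mul_of_nonneg_left h2 (mul_nonneg hw hlam0.le)
  simp only [hΦ]
  linarith

end

/-! ### The resolvent: convergence, explicit constants and the limit. -/

section
theorem MemL.abs_centred_le {X : Type*} [MeasurableSpace X] {W f : X → ℝ} (hW : ∀ x, 1 ≤ W x)
    (hf : MemL W f) (π : Measure X) (x : X) :
    |centred π f x| ≤ wNorm W (centred π f) * W x := by
  obtain ⟨R, hR⟩ := hf.2
  have hW0 : ∀ y, 0 < W y := fun y => zero_lt_one.trans_le (hW y)
  have hbdd : BddAbove (range fun y => |centred π f y| / W y) := by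
    refine ⟨R + |∫ y, f y ∂π|, ?_⟩
    rintro _ ⟨y, rfl⟩
    have h1 : |f y| / W y ≤ R := hR ⟨y, rfl⟩
    have h2 : |∫ y, f y ∂π| / W y ≤ |∫ y, f y ∂π| := div_le_self (abs_nonneg _) (hW y)
    calc |centred π f y| / W y ≤ (|f y| + |∫ y, f y ∂π|) / W y :=
          div_le_div_of_nonneg_right (abs_sub (f y) (∫ y, f y ∂π)) (hW0 y).le
      _ = |f y| / W y + |∫ y, f y ∂π| / W y := add_div _ _ _
      _ ≤ _ := add_le_add h1 h2
  rw [← div_le_iff₀ (hW0 x)]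
  exact le_ciSup hbdd x

theorem wNorm_nonneg {X : Type*} {W : X → ℝ} (hW : ∀ x, 0 ≤ W x) (f : X → ℝ) : 0 ≤ wNorm W f :=
  Real.iSup_nonneg fun x => div_nonneg (abs_nonneg _) (hW x)

theorem MemL.exists_abs_le {X : Type*} [MeasurableSpace X] {W f : X → ℝ} (hW : ∀ x, 1 ≤ W x)
    (hf : MemL W f) : ∃ R, ∀ x, |f x| ≤ R * W x := by
  obtain ⟨R, hR⟩ := hf.2
  exact ⟨R, fun x => (div_le_iff₀ (zero_lt_one.trans_le (hW x))).1 (hR ⟨x, rfl⟩)⟩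

theorem recip_nonneg (q : ℝ≥0∞) : 0 ≤ recip q := ENNReal.toReal_nonneg

theorem recip_le_one {q : ℝ≥0∞} (hq : 1 ≤ q) : recip q ≤ 1 := by
  have h := ENNReal.toReal_mono ENNReal.one_ne_top (ENNReal.inv_le_one.2 hq)
  rwa [ENNReal.toReal_one] at h

theorem exists_levelSet_pos {X : Type*} [MeasurableSpace X] (ν : Measure X) [NeZero ν]
    (V : X → ℝ) : ∃ d : ℝ, 0 < ν {y | V y ≤ d} := by
  by_contra! hcon
  have h1 : (univ : Set X) ⊆ ⋃ n : ℕ, {y | V y ≤ n} := fun x _ => by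
    obtain ⟨n, hn⟩ := exists_nat_ge (V x)
    exact mem_iUnion.2 ⟨n, hn⟩
  have h2 : ν univ = 0 := measure_mono_null h1
    (measure_iUnion_null fun n => le_antisymm (hcon n) zero_le)
  exact NeZero.ne ν (Measure.measure_univ_eq_zero.1 h2)

/-- A lower bound free of `t`, which lets `nstar` be chosen before the exponent `q`. -/
theorem min_one_inv_le_rpow_neg {y t : ℝ} (hy : 0 < y) (ht : 0 ≤ t) (ht1 : t ≤ 1) :
    min 1 y⁻¹ ≤ y ^ (-t) := by
  rcases le_total y 1 with h | h
  · exact (min_le_left _ _).trans (Real.one_le_rpow_of_pos_of_le_one_of_nonpos hy h (by linarith))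
  · refine (min_le_right _ _).trans ?_
    rw [← Real.rpow_neg_one]
    exact Real.rpow_le_rpow_of_exponent_le h (by linarith)

theorem inv_le_inv_one_sub_pow_mul {a : ℝ} (ha : 0 < a) (ha1 : a < 1) {n : ℕ} (hn : n ≠ 0) :
    1 / a ≤ (1 - (1 - a) ^ n)⁻¹ * n := by
  have h1 := one_add_mul_le_pow (show (-2 : ℝ) ≤ -a by linarith) n
  have h2 : (1 - a) ^ n < 1 := pow_lt_one₀ (by linarith) (by linarith) hn
  rw [← sub_eq_add_neg] at h1
  rw [← div_eq_inv_mul, div_le_div_iff₀ ha (by linarith)]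
  linarith

variable {X Θ : Type*} [MeasurableSpace X] [MeasurableSpace Θ] {M : AdaptiveChain X Θ}
  {C : Set X} {V : X → ℝ} {α b c : ℝ}

theorem AdaptiveChain.Drift.integrable_target (hdrift : M.Drift C V α b c)
    (hVm : Measurable V) (hV : ∀ x, 1 ≤ V x) (hα : 0 ≤ α) (hb : 0 ≤ b) (hc : 0 < c)
    {β β₀ : ℝ} (hβ : 0 ≤ β) (hβ' : β < 1 - α) (hβ₀ : 0 ≤ β₀) {π : Measure X}
    [IsProbabilityMeasure π] (herg : M.LevelSetErgodic V β₀ π) (x : X) (θ : Θ) {f : X → ℝ}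
    (hf : MemL (fun x => V x ^ β) f) : Integrable f π := by
  have hV0 : ∀ y, 0 ≤ V y := fun y => zero_le_one.trans (hV y)
  obtain ⟨R, hR⟩ := hf.exists_abs_le fun y => Real.one_le_rpow (hV y) hβ
  have hi : Integrable (fun y => V y ^ (1 - α)) π :=
    integrable_of_lintegral_ofReal_le (hVm.pow_const _) (fun y => Real.rpow_nonneg (hV0 y) _)
      (hdrift.lintegral_target_le hVm hV hα hb hc hβ₀ herg x θ)
  have hR0 : 0 ≤ R := by
    by_contra! h
    have h1 := mul_neg_of_neg_of_pos h
      (Real.rpow_pos_of_pos (zero_lt_one.trans_le (hV x)) β)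
    linarith [abs_nonneg (f x), hR x]
  exact (hi.const_mul R).mono' hf.1.aestronglyMeasurable (Eventually.of_forall fun y =>
    (hR y).trans (mul_le_mul_of_nonneg_left
      (Real.rpow_le_rpow_of_exponent_le (hV y) hβ'.le) hR0))

theorem measurable_centred {f : X → ℝ} (hf : Measurable f) (π : Measure X) :
    Measurable (centred π f) := hf.sub_const _

theorem integral_centred {f : X → ℝ} {π : Measure X} [IsProbabilityMeasure π]
    (hf : Integrable f π) : ∫ y, centred π f y ∂π = 0 := by
  unfold centred
  rw [integral_sub hf (integrable_const _)]
  simp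

theorem AdaptiveChain.Drift.integrable_centred_law (hdrift : M.Drift C V α b c)
    (hVm : Measurable V) (hV : ∀ x, 1 ≤ V x) (hα : 0 ≤ α) (hb : 0 ≤ b)
    {β : ℝ} (hβ : 0 ≤ β) (hβ' : β < 1 - α) (π : Measure X)
    {f : X → ℝ} (hf : MemL (fun x => V x ^ β) f) (l j : ℕ) (z : X × Θ) :
    Integrable (fun ω => centred π f (ω j).1) (M.law l z) := by
  have hV1 : ∀ x, 1 ≤ V x ^ β := fun y => Real.one_le_rpow (hV y) hβ
  have hi : Integrable (fun z' : X × Θ => V z'.1 ^ β) (M.nStep l j z) :=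
    hdrift.integrable_rpow_nStep hVm hV hα hb (by linarith) l j z
  have hm : Measurable fun z' : X × Θ => centred π f z'.1 :=
    (measurable_centred hf.1 π).comp measurable_fst
  have h1 : Integrable (fun z' : X × Θ => centred π f z'.1) (M.nStep l j z) :=
    (hi.const_mul _).mono' hm.aestronglyMeasurable
      (Eventually.of_forall fun z' => hf.abs_centred_le hV1 π z'.1)
  rw [← M.law_map_eval, integrable_map_measure hm.aestronglyMeasurable
    (measurable_pi_apply j).aemeasurable] at h1
  exact h1

/-- The resolvent series converges absolutely and is at most `2 ε / a`, up to a constant and a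
term controlled by `V ^ (β + α t)`, for every `t ∈ [0, 1]`. -/
theorem AdaptiveChain.Drift.exists_resolvent_bound (hdrift : M.Drift C V α b c)
    (hVm : Measurable V) (hV : ∀ x, 1 ≤ V x) (hα : 0 < α) (hb : 0 ≤ b) (hc : 0 < c)
    {ν : Measure X} [IsProbabilityMeasure ν] {ε₀ : ℝ} (hε₀ : 0 < ε₀)
    (hmin : M.Minorization C ε₀ ν)
    {β β₀ : ℝ} (hβ : 0 ≤ β) (hβ' : β < 1 - α) (hβ₀ : 0 ≤ β₀)
    {π : Measure X} [IsProbabilityMeasure π]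
    (herg : M.LevelSetErgodic V β₀ π) (hdim : M.DiminishingAdaptation V)
    {d : ℝ} (hd : 0 < ν {y | V y ≤ d}) {ε : ℝ} (hε : 0 < ε) :
    ∃ n : ℕ, 2 ≤ n ∧ ∃ K : ℝ, 0 ≤ K ∧ ∀ a : ℝ, 0 < a → a < 1 → ∀ f : X → ℝ,
      MemL (fun x => V x ^ β) f → ∀ (l : ℕ) (x : X) (θ : Θ) (t : ℝ), 0 ≤ t → t ≤ 1 →
      (Summable fun j : ℕ =>
        (1 - a) ^ (j + 1) * ∫ ω, centred π f (ω j).1 ∂(M.law l (x, θ))) ∧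
      |M.resolvent π f a l (x, θ)| ≤ wNorm (fun x => V x ^ β) (centred π f) *
        (2 * ε / a + K + (a ^ (1 - t) * ((1 - a) * (α * c)) ^ t)⁻¹ *
          (V x ^ (β + α * t) + b * (ε₀ * ν.real {y | V y ≤ d})⁻¹)) := by
  obtain ⟨n, hn, K, hK, hbound⟩ :=
    hdrift.exists_levelSet_bound hVm hV hα.le hb hc hβ hβ' hβ₀ herg hdim d hε
  refine ⟨n, hn, K, hK, fun a ha ha1 f hf l x θ t ht ht1 => ?_⟩
  have ha' : 0 < 1 - a := by linarith
  have hV1 : ∀ x, 1 ≤ V x ^ β := fun y => Real.one_le_rpow (hV y) hβ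
  have hm := measurable_centred hf.1 π
  set w := wNorm (fun x => V x ^ β) (centred π f) with hw
  have hw0 : 0 ≤ w := wNorm_nonneg (fun y => zero_le_one.trans (hV1 y)) _
  have hfi : Integrable f π :=
    hdrift.integrable_target hVm hV hα.le hb hc hβ hβ' hβ₀ herg x θ hf
  have hsum := hdrift.discounted_sum_le_of_levelSet hVm hV hα hb hc hε₀ hmin hd hβ hβ' ht ht1
    ha ha1 hw0 (by positivity) hm (hf.abs_centred_le hV1 π)
    (fun l x θ hx N => hbound a ha ha1 _ hm w hw0 (hf.abs_centred_le hV1 π)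
      (integral_centred hfi) l x θ hx N)
  have hterm : ∀ j : ℕ, ∫ ω, centred π f (ω j).1 ∂(M.law l (x, θ)) =
      ∫ z', centred π f z'.1 ∂(M.nStep l j (x, θ)) := fun j =>
    M.integral_law_eval l j (x, θ) (g := fun z' => centred π f z'.1) (hm.comp measurable_fst)
  have habs : ∀ j : ℕ, ‖(1 - a) ^ (j + 1) * ∫ ω, centred π f (ω j).1 ∂(M.law l (x, θ))‖ =
      (1 - a) ^ (j + 1) * |∫ z', centred π f z'.1 ∂(M.nStep l j (x, θ))| := fun j => by
    rw [hterm, norm_mul, Real.norm_of_nonneg (by positivity), Real.norm_eq_abs]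
  have hN := fun N => hsum N l x θ
  simp only [← habs] at hN
  have hs := summable_of_sum_range_le (fun j => norm_nonneg _) hN
  refine ⟨hs.of_norm, ?_⟩
  have h1 := (norm_tsum_le_tsum_norm hs).trans
    (Real.tsum_le_of_sum_range_le (fun j => norm_nonneg _) hN)
  rw [Real.norm_eq_abs] at h1
  unfold AdaptiveChain.resolvent
  refine h1.trans_eq ?_
  ring

theorem AdaptiveChain.Drift.tendsto_mul_resolvent (hdrift : M.Drift C V α b c)
    (hVm : Measurable V) (hV : ∀ x, 1 ≤ V x) (hα : 0 < α) (hb : 0 ≤ b) (hc : 0 < c)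
    {ν : Measure X} [IsProbabilityMeasure ν] {ε₀ : ℝ} (hε₀ : 0 < ε₀)
    (hmin : M.Minorization C ε₀ ν)
    {β β₀ : ℝ} (hβ : 0 ≤ β) (hβ' : β < 1 - α) (hβ₀ : 0 ≤ β₀)
    {π : Measure X} [IsProbabilityMeasure π]
    (herg : M.LevelSetErgodic V β₀ π) (hdim : M.DiminishingAdaptation V) {f : X → ℝ}
    (hf : MemL (fun x => V x ^ β) f) (l : ℕ) (x : X) (θ : Θ) :
    Tendsto (fun a : ℝ => a * M.resolvent π f a l (x, θ)) (𝓝[>] 0) (𝓝 0) := by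
  obtain ⟨d, hd⟩ := exists_levelSet_pos ν V
  set w := wNorm (fun x => V x ^ β) (centred π f) with hw
  have hw0 : 0 ≤ w := wNorm_nonneg
    (fun y => zero_le_one.trans (Real.one_le_rpow (hV y) hβ)) _
  rw [Metric.tendsto_nhds]
  intro r hr
  set ε := r / (2 * (w + 1)) with hεdef
  have hε : 0 < ε := by positivity
  -- Used below with `t = 1`, where the coefficient of the `V`-term stays bounded as `a` tends to
  -- zero, so multiplication by `a` leaves only `w * ε`.
  obtain ⟨n, -, K, hK, hbound⟩ := hdrift.exists_resolvent_bound hVm hV hα hb hc hε₀ hmin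
    hβ hβ' hβ₀ herg hdim hd (half_pos hε)
  set R := V x ^ (β + α * 1) + b * (ε₀ * ν.real {y | V y ≤ d})⁻¹ with hR
  have hlim : Tendsto (fun a : ℝ => w * (ε + a * (K + ((1 - a) * (α * c))⁻¹ * R))) (𝓝[>] 0)
      (𝓝 (w * (ε + 0 * (K + ((1 - 0) * (α * c))⁻¹ * R)))) := by
    refine tendsto_nhdsWithin_of_tendsto_nhds (ContinuousAt.tendsto (f := fun a : ℝ =>
      w * (ε + a * (K + ((1 - a) * (α * c))⁻¹ * R))) (x := 0) ?_)
    have hne : (1 - (0 : ℝ)) * (α * c) ≠ 0 := by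
      rw [sub_zero, one_mul]
      positivity
    fun_prop (disch := assumption)
  have hlt : w * (ε + 0 * (K + ((1 - 0) * (α * c))⁻¹ * R)) < r := by
    rw [zero_mul, add_zero, hεdef, ← mul_div_assoc, div_lt_iff₀ (by positivity)]
    nlinarith
  filter_upwards [hlim.eventually_lt_const hlt, Ioo_mem_nhdsGT (zero_lt_one' ℝ)] with a h1 ha
  have h2 := (hbound a ha.1 ha.2 f hf l x θ 1 zero_le_one le_rfl).2
  rw [Real.dist_eq, sub_zero, abs_mul, abs_of_pos ha.1]
  refine lt_of_le_of_lt ?_ h1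
  rw [sub_self, Real.rpow_zero, one_mul, Real.rpow_one] at h2
  refine (mul_le_mul_of_nonneg_left h2 ha.1.le).trans_eq ?_
  have h3 : a * (2 * (ε / 2) / a) = ε := by
    have := ha.1.ne'
    field_simp
  calc _ = w * (a * (2 * (ε / 2) / a) + a * (K + ((1 - a) * (α * c))⁻¹ * R)) := by ring
    _ = _ := by rw [h3]

/-- The resolvent bound with explicit dependence on the level set and the exponent. -/
theorem AdaptiveChain.Drift.exists_explicit_resolvent_bound (hdrift : M.Drift C V α b c)
    (hVm : Measurable V) (hV : ∀ x, 1 ≤ V x) (hα : 0 < α) (hb : 0 ≤ b) (hc : 0 < c)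
    {ν : Measure X} [IsProbabilityMeasure ν] {ε₀ : ℝ} (hε₀ : 0 < ε₀)
    (hmin : M.Minorization C ε₀ ν)
    {β β₀ : ℝ} (hβ : 0 ≤ β) (hβ' : β < 1 - α) (hβ₀ : 0 ≤ β₀)
    {π : Measure X} [IsProbabilityMeasure π]
    (herg : M.LevelSetErgodic V β₀ π) (hdim : M.DiminishingAdaptation V)
    {d : ℝ} (hd : 0 < ν {y | V y ≤ d}) {ε : ℝ} (hε : 0 < ε) {B : ℝ} (hbB : b ≤ B) (hB : 1 ≤ B) :
    ∃ n : ℕ, 2 ≤ n ∧ ∃ nstar : ℕ, ∀ a : ℝ, 0 < a → a < 1 → ∀ f : X → ℝ,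
      MemL (fun x => V x ^ β) f → ∀ (l : ℕ) (x : X) (θ : Θ) (t : ℝ), 0 ≤ t → t ≤ 1 →
      |M.resolvent π f a l (x, θ)| ≤ wNorm (fun x => V x ^ β) (centred π f) *
        (4 * ε * (1 - (1 - a) ^ n)⁻¹ * n +
          V x ^ (β + α * t) / (a ^ (1 - t) * (1 - a) ^ t) * (α * c) ^ (-t) *
            (1 + B * (ε₀ * ν.real {y | V y ≤ d})⁻¹ + 2 * (1 + B * nstar) * (1 + B) *
              sSup ((fun y => V y ^ (β + α * t)) '' {y | V y ≤ d}))) := by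
  obtain ⟨n, hn, K, hK, hbound⟩ := hdrift.exists_resolvent_bound hVm hV hα hb hc hε₀ hmin
    hβ hβ' hβ₀ herg hdim hd hε
  have hαc : 0 < α * c := by positivity
  have hm0 : 0 < min 1 (α * c)⁻¹ := lt_min one_pos (by positivity)
  -- The prefactor of the last bracket is at least `min 1 (α * c)⁻¹`, so this many units of it cover
  -- `K`.
  refine ⟨n, hn, ⌈K / min 1 (α * c)⁻¹⌉₊, fun a ha ha1 f hf l x θ t ht ht1 => ?_⟩
  have ha' : 0 < 1 - a := by linarith
  refine (hbound a ha ha1 f hf l x θ t ht ht1).2.trans (mul_le_mul_of_nonneg_left ?_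
    (wNorm_nonneg (fun y => zero_le_one.trans (Real.one_le_rpow (hV y) hβ)) _))
  set nstar := ⌈K / min 1 (α * c)⁻¹⌉₊ with hnstar
  set s := β + α * t with hs
  have hs0 : 0 ≤ s := by positivity
  have hνD : 0 < ν.real {y | V y ≤ d} := ENNReal.toReal_pos hd.ne' (measure_ne_top _ _)
  set u := (ε₀ * ν.real {y | V y ≤ d})⁻¹ with hu
  have hu0 : 0 ≤ u := by positivity
  set S := sSup ((fun y => V y ^ s) '' {y | V y ≤ d}) with hS
  have hS1 : 1 ≤ S := by
    obtain ⟨y, hy⟩ := nonempty_of_measure_ne_zero hd.ne'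
    have hbdd : BddAbove ((fun y => V y ^ s) '' {y | V y ≤ d}) := by
      refine ⟨d ^ s, ?_⟩
      rintro _ ⟨y, hy, rfl⟩
      exact Real.rpow_le_rpow (zero_le_one.trans (hV y)) hy hs0
    exact (Real.one_le_rpow (hV y) hs0).trans (le_csSup hbdd ⟨y, hy, rfl⟩)
  have hVs : 1 ≤ V x ^ s := Real.one_le_rpow (hV x) hs0
  set den := a ^ (1 - t) * (1 - a) ^ t with hden
  have hden0 : 0 < den := by positivity
  have hden1 : den ≤ 1 := mul_le_one₀ (Real.rpow_le_one ha.le ha1.le (by linarith))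
    (by positivity) (Real.rpow_le_one ha'.le (by linarith) ht)
  have hlam : (a ^ (1 - t) * ((1 - a) * (α * c)) ^ t)⁻¹ = den⁻¹ * (α * c) ^ (-t) := by
    rw [Real.mul_rpow ha'.le hαc.le, Real.rpow_neg hαc.le, ← mul_assoc, mul_inv]
  rw [hlam]
  set e := (α * c) ^ (-t) with he
  have he0 : 0 < e := by positivity
  have hmix : 2 * ε / a ≤ 4 * ε * (1 - (1 - a) ^ n)⁻¹ * n := by
    have h1 := inv_le_inv_one_sub_pow_mul ha ha1 (show n ≠ 0 by omega)
    have h2 : 0 ≤ 1 / a := by positivity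
    calc 2 * ε / a = 2 * ε * (1 / a) := by ring
      _ ≤ 4 * ε * (1 / a) := by gcongr; norm_num
      _ ≤ 4 * ε * ((1 - (1 - a) ^ n)⁻¹ * n) := by gcongr
      _ = _ := by ring
  have hA : 1 ≤ V x ^ s / den := (one_le_div hden0).2 (hden1.trans hVs)
  have hlow : min 1 (α * c)⁻¹ ≤ V x ^ s / den * e :=
    (min_one_inv_le_rpow_neg hαc ht ht1).trans (le_mul_of_one_le_left he0.le hA)
  have hmain : den⁻¹ * e * (V x ^ s + b * u) ≤ V x ^ s / den * e * (1 + B * u) := by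
    have h1 : b * u ≤ V x ^ s * (B * u) :=
      (mul_le_mul_of_nonneg_right hbB hu0).trans (le_mul_of_one_le_left (by positivity) hVs)
    calc _ ≤ den⁻¹ * e * (V x ^ s + V x ^ s * (B * u)) := by gcongr
      _ = _ := by ring
  have hKle : K ≤ V x ^ s / den * e * (2 * (1 + B * nstar) * (1 + B) * S) := by
    have h1 : K ≤ min 1 (α * c)⁻¹ * nstar := by
      rw [← div_le_iff₀' hm0]; exact Nat.le_ceil _
    have hn0 : (0 : ℝ) ≤ nstar := nstar.cast_nonneg
    have h2 : (nstar : ℝ) ≤ 2 * (1 + B * nstar) * (1 + B) * S := by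
      have h3 : (nstar : ℝ) ≤ B * nstar := le_mul_of_one_le_left hn0 hB
      have h4 : (1 : ℝ) ≤ 2 * (1 + B) * S := by nlinarith
      have h5 : (1 + B * nstar) * 1 ≤ (1 + B * nstar) * (2 * (1 + B) * S) := by gcongr
      linarith
    calc K ≤ min 1 (α * c)⁻¹ * nstar := h1
      _ ≤ _ := mul_le_mul hlow h2 hn0 (hm0.le.trans hlow)
  linarith

end

end AdaptiveMCMC

end

theorem theorem4p1 {X Θ : Type*} [MeasurableSpace X] [MeasurableSpace Θ]
    (M : AdaptiveChain X Θ)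
    (ν : Measure X) [IsProbabilityMeasure ν] (ε₀ : ℝ) (hε₀ : 0 < ε₀)
    (C : Set X) (hC : MeasurableSet C) (hmin : M.Minorization C ε₀ ν)
    (V : X → ℝ) (hVm : Measurable V) (hV : ∀ x, 1 ≤ V x)
    (α b c : ℝ) (hα : 0 < α) (hα1 : α < 1) (hb : 0 < b) (hc : 0 < c)
    (hdrift : M.Drift C V α b c)
    (π : Measure X) [IsProbabilityMeasure π] (β₀ : ℝ) (hβ₀ : 0 ≤ β₀) (hβ₀' : β₀ < 1 - α)
    (herg : M.LevelSetErgodic V β₀ π)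
    (hdim : M.DiminishingAdaptation V) :
    -- the resolvent is well defined
    (∀ β : ℝ, 0 ≤ β → β < 1 - α → ∀ f : X → ℝ, MemL (fun x => V x ^ β) f →
      ∀ (l : ℕ) (x : X) (θ : Θ), Integrable f π ∧
        (∀ j : ℕ, Integrable (fun ω => centred π f (ω j).1) (M.law l (x, θ))) ∧
        ∀ a : ℝ, 0 < a → a < 1 → Summable fun j : ℕ =>
          (1 - a) ^ (j + 1) * ∫ ω, centred π f (ω j).1 ∂(M.law l (x, θ))) ∧
    -- the explicit bound
    (∃ bbar : ℝ, 0 ≤ bbar ∧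
      (∀ β : ℝ, 0 ≤ β → β ≤ 1 → M.MeanLE (fun x => V x ^ β)
        (fun x => V x ^ β - β * c * V x ^ (β - α) + bbar * C.indicator 1 x)) ∧
      (∀ β : ℝ, 0 ≤ β → β ≤ 1 → ∀ (j l : ℕ) (x : X) (θ : Θ),
        ∫⁻ ω, ENNReal.ofReal (V (ω j).1 ^ β) ∂(M.law l (x, θ)) ≤
          ENNReal.ofReal (V x ^ β + bbar * (j : ℝ) ^ β)) ∧
      ∀ β : ℝ, 0 ≤ β → β < 1 - α → ∀ d : ℝ, 0 < ν {y | V y ≤ d} → ∀ ε : ℝ, 0 < ε →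
        ∃ n : ℕ, 2 ≤ n ∧ ∃ nstar : ℕ,
          ∀ a : ℝ, 0 < a → a < 1 → ∀ f : X → ℝ, MemL (fun x => V x ^ β) f →
          ∀ (l : ℕ) (x : X) (θ : Θ) (q : ℝ≥0∞), 1 ≤ q →
            |M.resolvent π f a l (x, θ)| ≤ wNorm (fun x => V x ^ β) (centred π f) *
              (4 * ε * (1 - (1 - a) ^ n)⁻¹ * n +
                V x ^ (β + α * recip q) / (a ^ (1 - recip q) * (1 - a) ^ recip q) *
                  (α * c) ^ (-recip q) *
                  (1 + bbar * (ε₀ * ν.real {y | V y ≤ d})⁻¹ +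
                    2 * (1 + bbar * nstar) * (1 + bbar) *
                      sSup ((fun y => V y ^ (β + α * recip q)) '' {y | V y ≤ d})))) ∧
    -- the limit
    (∀ β : ℝ, 0 ≤ β → β < 1 - α → ∀ f : X → ℝ, MemL (fun x => V x ^ β) f →
      ∀ (l : ℕ) (x : X) (θ : Θ),
        Tendsto (fun a : ℝ => a * M.resolvent π f a l (x, θ)) (𝓝[>] 0) (𝓝 0)) := by
  have hα0 := hα.le
  have hb0 := hb.le
  -- The choice `max b 1` instead of `b` ensures `b ^ s ≤ bbar` for all `s` in `[0, 1]`, and `nstar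
  -- ≤ bbar * nstar` in the explicit bound.
  refine ⟨fun β hβ hβ' f hf l x θ => ⟨?_, fun j => ?_, fun a ha ha1 => ?_⟩,
    ⟨max b 1, le_max_of_le_right zero_le_one, fun β hβ hβ1 θ x => ?_,
      fun β hβ hβ1 j l x θ => ?_, fun β hβ hβ' d hd ε hε => ?_⟩,
    fun β hβ hβ' f hf l x θ => ?_⟩
  · exact hdrift.integrable_target hVm hV hα0 hb0 hc hβ hβ' hβ₀ herg x θ hf
  · exact hdrift.integrable_centred_law hVm hV hα0 hb0 hβ hβ' π hf l j (x, θ)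
  · obtain ⟨d, hd⟩ := exists_levelSet_pos ν V
    obtain ⟨n, -, K, -, h⟩ := hdrift.exists_resolvent_bound hVm hV hα hb0 hc hε₀ hmin
      hβ hβ' hβ₀ herg hdim hd one_pos
    exact (h a ha ha1 f hf l x θ 0 le_rfl zero_le_one).1
  · refine lintegral_ofReal_le_of_integral_le
      (integrable_rpow hVm hV (hdrift.integrable hVm hV θ x) hβ1)
      (fun y => Real.rpow_nonneg (zero_le_one.trans (hV y)) _)
      ((hdrift.integral_rpow_le hVm hV hb0 hβ hβ1 θ x).trans ?_)
    have h1 : b * C.indicator (1 : X → ℝ) x ≤ max b 1 * C.indicator 1 x :=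
      mul_le_mul_of_nonneg_right (le_max_left b 1)
        (indicator_nonneg (fun _ _ => zero_le_one) x)
    linarith
  · have hm : Measurable fun z' : X × Θ => ENNReal.ofReal (V z'.1 ^ β) :=
      ((hVm.comp measurable_fst).pow_const β).ennreal_ofReal
    have h1 : ∫⁻ ω, ENNReal.ofReal (V (ω j).1 ^ β) ∂(M.law l (x, θ)) =
        ∫⁻ z', ENNReal.ofReal (V z'.1 ^ β) ∂(M.nStep l j (x, θ)) := by
      rw [← M.law_map_eval, lintegral_map hm (measurable_pi_apply j)]
    rw [h1]
    exact lintegral_ofReal_le_of_integral_le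
      (hdrift.integrable_rpow_nStep hVm hV hα0 hb0 hβ1 l j (x, θ))
      (fun y => Real.rpow_nonneg (zero_le_one.trans (hV y.1)) _)
      (hdrift.integral_rpow_nStep_le hVm hV hα0 hb0 hc.le hβ hβ1 l j (x, θ))
  · obtain ⟨n, hn, nstar, h⟩ := hdrift.exists_explicit_resolvent_bound hVm hV hα hb0 hc hε₀ hmin
      hβ hβ' hβ₀ herg hdim hd hε (le_max_left b 1) (le_max_right b 1)
    exact ⟨n, hn, nstar, fun a ha ha1 f hf l x θ q hq =>
      h a ha ha1 f hf l x θ (recip q) (recip_nonneg q) (recip_le_one hq)⟩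
  · exact hdrift.tendsto_mul_resolvent hVm hV hα hb0 hc hε₀ hmin hβ hβ' hβ₀ herg hdim hf l x θ
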